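/- Let $\Gamma=(V,U,E)$ be a finite bipartite graph embedded in the plane (vertices are distinct points, edges are simple arcs that meet only at common endpoints), and let $n=|E|$. To each generator $x\in V$ and each recognizer $c\in U$ let there be attached tensors $G_x\in\bigotimes_{e\ni x}\mathbb C^2$ and $R_c\in\bigotimes_{e\ni c}(\mathbb C^2)^*$, already written in the bases obtained by a change of basis $T_e\in GL_2(\mathbb C)$ on each $\mathbb C^2$ (for instance the same for all $e$) and the dual change of basis on its dual. For a set $I$ of edges, the coordinate with index $I$ of a tensor is the one at the basis vector with $1$ in the slots of $I$ and $0$ elsewhere. Put $G=\bigotimes_x G_x$, $R=\bigotimes_c R_c$. Let $C$ be an oriented simple closed curve in the plane with a starting point that crosses every edge exactly once, that is, it meets the edge in one point, and the two ends of the edge are off $C$ and on different sides of $C$. If $\Gamma$ is not connected, assume moreover that the generators of all edges lie on the same side of $C$. Let $\bar E^C$ be the order in which $C$ meets the edges. Let $\bar E^C_G$ be the edge order in which the edges at each generator are consecutive and for which the word $\pi(1),\dots,\pi(n)$ is lexicographically minimal, where $\pi$ sends the position of an edge in $\bar E^C_G$ to its position in $\bar E^C$. Define $\bar E^C_R$ and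 $\tau$ in the same way with recognizers in place of generators. Assume that all $G_x$, in the order $\bar E_G^C$, and all $R_c$, with complementary indexing and in the order $\bar E_R^C$, satisfy the Grassmann–Plücker relations: a vector $(v_I)$ indexed by the subsets of an ordered finite set satisfies them if for all subsets $\alpha,\beta$, with $\alpha\triangle\beta=\{p_1<\dots<p_l\}$, one has $\sum_{i=1}^l(-1)^i v_{\alpha\triangle\{p_i\}}v_{\beta\triangle\{p_i\}}=0$. Assume also that the coordinate of each $G_x$ with index $\emptyset$ and the coordinate of each $R_c$ whose index is the set of all edges at $c$ are non-zero. Let $\hat G=G/G_\emptyset$ and $\hat R=R/R_E$. For a skew-symmetric $n\times n$ matrix $z$ and $I\subseteq[n]$ let $\operatorname{sPf}(z)_I=\operatorname{Pfaff}(z_I)$ and $\operatorname{sPf}^\vee(z)_I=\operatorname{Pfaff}(z_{[n]\setminus I})$, where $z_I$ consists of the rows and columns in $I$. A permutation $\pi$ of $[n]$ acts by $\pi(z)_{\pi(i)\pi(j)}=z_{ij}$ and $\pi(v)_{\pi(I)}=v_I$. For a set $S$ of disjoint pairs of edges and an edge order $\bar E$, let $\operatorname{cr}(S,\bar E)$ be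 the number of $(\{a,a'\},\{b,b'\})\in S\times S$ with $a<b<a'<b'$ in $\bar E$. Then: 1. There is a skew-symmetric $z$ with $\operatorname{sPf}(z)=\hat G$ in the order $\bar E^C_G$, and every such $z$ satisfies $\operatorname{sPf}(\pi(z))=\pi(\operatorname{sPf}(z))$. 2. For every partition $S$ of a set of edges into pairs such that the two edges of each pair share a generator, $\operatorname{cr}(S,\bar E^C)=\sum_{x\in V}\operatorname{cr}(S|_x,\bar E^C_G)$, where $S|_x$ consists of the pairs of edges at $x$. 3. The same holds for recognizers: there is a skew-symmetric $y$ with $\operatorname{sPf}^\vee(y)=\hat R$ in the order $\bar E^C_R$, every such $y$ satisfies $\operatorname{sPf}^\vee(\tau(y))=\tau(\operatorname{sPf}^\vee(y))$, and $\operatorname{cr}(S,\bar E^C)=\sum_{c\in U}\operatorname{cr}(S|_c,\bar E^C_R)$ for every partition $S$ of a set of edges into pairs that share a recognizer. 4. The order $\bar E^C$ is valid: there are skew-symmetric $z,y$ with $\operatorname{sPf}(z)=\hat G$ and $\operatorname{sPf}^\vee(y)=\hat R$ in the order $\bar E^C$. -/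

import Mathlib

/-! ### Pfaffians and vectors of sub-Pfaffians -/

/-- The Pfaffian of a (skew-symmetric) matrix, by expansion along the first row:
`Pf A = ∑_{j ≥ 2} (-1)^j a_{1j} Pf (A without rows and columns 1, j)`, with `Pf = 1` for the
empty matrix and `Pf = 0` in size one.  (In the code `j - 2` is called `j`.) -/
noncomputable def pfaffian : (n : ℕ) → Matrix (Fin n) (Fin n) ℂ → ℂ
  | 0, _ => 1
  | 1, _ => 0
  | n + 2, A => ∑ j : Fin (n + 1), (-1) ^ (j : ℕ) * A 0 j.succ *
      pfaffian n (A.submatrix (fun k => (j.succAbove k).succ) (fun k => (j.succAbove k).succ))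

/-- `Pf (z_I)`, where `z_I` consists of the rows and columns of `z` in `I`, in increasing order. -/
noncomputable def sPf {n : ℕ} (z : Matrix (Fin n) (Fin n) ℂ) (I : Finset (Fin n)) : ℂ :=
  pfaffian I.card (z.submatrix (I.orderEmbOfFin rfl) (I.orderEmbOfFin rfl))

/-- The dual vector of sub-Pfaffians: `I ↦ Pf (z_{Iᶜ})`. -/
noncomputable def sPfDual {n : ℕ} (z : Matrix (Fin n) (Fin n) ℂ) (I : Finset (Fin n)) : ℂ :=
  sPf z Iᶜ

def IsSkew {n : ℕ} (z : Matrix (Fin n) (Fin n) ℂ) : Prop := z.transpose = -z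

/-- The action of a permutation on matrices: `(π z)_{π i, π j} = z_{i, j}`. -/
def permMatrix {n : ℕ} (π : Equiv.Perm (Fin n)) (z : Matrix (Fin n) (Fin n) ℂ) :
    Matrix (Fin n) (Fin n) ℂ := Matrix.reindex π π z

/-- The action of a permutation on vectors indexed by subsets: `(π v)_{π I} = v_I`. -/
def permVec {n : ℕ} (π : Equiv.Perm (Fin n)) (v : Finset (Fin n) → ℂ) : Finset (Fin n) → ℂ :=
  fun I => v (I.map π.symm.toEmbedding)

/-! ### Edge orders

An order of a set `ε` of edges is a bijection `Fin n ≃ ε` (position to edge).  The map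
`f : ε → W` sends an edge to its generator, or to its recognizer. -/

/-- The permutation `π` with `π(A) = B`: an edge in position `k` of `A` is in position `π k`
of `B`. -/
def orderPerm {n : ℕ} {ε : Type*} (A B : Fin n ≃ ε) : Equiv.Perm (Fin n) := A.trans B.symm

/-- Edges with the same end under `f` are adjacent in the order: a generator order if `f` gives
the generator of an edge, a recognizer order if `f` gives its recognizer. -/
def IsGroupedOrder {n : ℕ} {ε W : Type*} (f : ε → W) (A : Fin n ≃ ε) : Prop :=
  ∀ i j k : Fin n, i < j → j < k → f (A i) = f (A k) → f (A j) = f (A i)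

/-- `A` is the grouped order for which the permutation from `A` to `B`, as a word
`π 0, π 1, …`, is lexicographically minimal. -/
def IsLexMinGroupedOrder {n : ℕ} {ε W : Type*} (f : ε → W) (B A : Fin n ≃ ε) : Prop :=
  IsGroupedOrder f A ∧ ∀ A' : Fin n ≃ ε, IsGroupedOrder f A' →
    toLex (fun k => orderPerm A B k) ≤ toLex (fun k => orderPerm A' B k)

/-! ### Tensors

A tensor in `⨂_{e ∈ κ} ℂ²` (or its dual) is given by its coordinates in the standard basis,
which are indexed by `κ → Fin 2`. -/

/-- The edges `e` with end `f e = w`. -/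
abbrev EdgesAt {ε W : Type*} (f : ε → W) (w : W) : Type _ := {e : ε // f e = w}

/-- The action of `⨂_e T_e` on a tensor. -/
noncomputable def changeBasis {κ : Type*} [Fintype κ] [DecidableEq κ]
    (T : κ → Matrix (Fin 2) (Fin 2) ℂ) (τ : (κ → Fin 2) → ℂ) : (κ → Fin 2) → ℂ :=
  fun x => ∑ y : κ → Fin 2, (∏ e, T e (x e) (y e)) * τ y

/-- The tensor product over all `w` of tensors on the edges at `w`. -/
noncomputable def globalTensor {ε W : Type*} [Fintype W] (f : ε → W)
    (τ : (w : W) → (EdgesAt f w → Fin 2) → ℂ) : (ε → Fin 2) → ℂ :=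
  fun x => ∏ w, τ w (fun e => x e.1)

/-- The coordinate of a tensor at the basis vector with `1` exactly in the slots in `I`. -/
def coord {κ : Type*} [DecidableEq κ] (τ : (κ → Fin 2) → ℂ) (I : Finset κ) : ℂ :=
  τ (fun e => if e ∈ I then 1 else 0)

/-- The vector indexed by sets of positions that an edge order makes out of a tensor. -/
def orderVec {n : ℕ} {ε : Type*} [DecidableEq ε] (A : Fin n ≃ ε) (τ : (ε → Fin 2) → ℂ) :
    Finset (Fin n) → ℂ := fun I => coord τ (I.map A.toEmbedding)

/-- Rescaling that makes the first entry (all slots `0`) equal to `1`. -/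
noncomputable def normalizeFirst {ε : Type*} (τ : (ε → Fin 2) → ℂ) : (ε → Fin 2) → ℂ :=
  fun x => (τ fun _ => 0)⁻¹ * τ x

/-- Rescaling that makes the last entry (all slots `1`) equal to `1`. -/
noncomputable def normalizeLast {ε : Type*} (τ : (ε → Fin 2) → ℂ) : (ε → Fin 2) → ℂ :=
  fun x => (τ fun _ => 1)⁻¹ * τ x

/-- The Grassmann–Plücker relations (matchgate identities): for all `α, β`, if
`p₁ < p₂ < …` are the positions where `α` and `β` differ, then
`∑ i, (-1)^i τ(α ∆ {p_i}) τ(β ∆ {p_i}) = 0`.  The slots are ordered by `pos`. -/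
def GrassmannPlucker {κ : Type*} [DecidableEq κ] {n : ℕ} (pos : κ → Fin n)
    (τ : Finset κ → ℂ) : Prop :=
  ∀ α β : Finset κ, ∑ p ∈ symmDiff α β,
    (-1 : ℂ) ^ ((symmDiff α β).filter (fun q => pos q < pos p)).card *
      τ (symmDiff α {p}) * τ (symmDiff β {p}) = 0

/-- An order is valid for `G` and `R` if in it `G = sPf z` and `R = sPf^∨ y` for some
skew-symmetric `z` and `y`. -/
def IsValidOrder {n : ℕ} {ε : Type*} [DecidableEq ε] (A : Fin n ≃ ε)
    (G R : (ε → Fin 2) → ℂ) : Prop :=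
  ∃ z y : Matrix (Fin n) (Fin n) ℂ, IsSkew z ∧ IsSkew y ∧
    sPf z = orderVec A G ∧ sPfDual y = orderVec A R

/-! ### Pairings and crossing numbers -/

/-- `S` is a partition of `I` into pairs. -/
def IsPairing {ε : Type*} [DecidableEq ε] (I : Finset ε) (S : Finset (Finset ε)) : Prop :=
  (∀ p ∈ S, p.card = 2) ∧ (S : Set (Finset ε)).PairwiseDisjoint id ∧ S.biUnion id = I

/-- A pairing in which the two edges of each pair share their end under `f`. -/
def IsPairingAlong {ε W : Type*} [DecidableEq ε] (f : ε → W) (I : Finset ε)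
    (S : Finset (Finset ε)) : Prop :=
  IsPairing I S ∧ ∀ p ∈ S, ∃ w, ∀ e ∈ p, f e = w

/-- The part of a pairing at `w`. -/
def pairingAt {ε W : Type*} [DecidableEq W] (f : ε → W) (w : W)
    (S : Finset (Finset ε)) : Finset (Finset ε) :=
  S.filter (fun p => ∀ e ∈ p, f e = w)

/-- The pairs `p = {a, a'}`, `q = {b, b'}` cross: `a < b < a' < b'` in the order `A`. -/
def Crosses {n : ℕ} {ε : Type*} [DecidableEq ε] (A : Fin n ≃ ε) (p q : Finset ε) : Prop :=
  ∃ a b a' b' : ε, p = {a, a'} ∧ q = {b, b'} ∧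
    A.symm a < A.symm b ∧ A.symm b < A.symm a' ∧ A.symm a' < A.symm b'

open Classical in
/-- The crossing number of a set of pairs with respect to an edge order. -/
noncomputable def crossingNumber {n : ℕ} {ε : Type*} [DecidableEq ε] (A : Fin n ≃ ε)
    (S : Finset (Finset ε)) : ℕ :=
  ((S ×ˢ S).filter (fun pq => Crosses A pq.1 pq.2)).card

/-! ### Plane bipartite graphs and `C`-orderings

A bipartite graph with generators `V` and recognizers `U` is given by its edge set
`E : Finset (V × U)`. -/

/-- The generator (variable) of an edge. -/
def genOf {V U : Type*} {E : Finset (V × U)} (e : E) : V := e.1.1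

/-- The recognizer (clause) of an edge. -/
def recOf {V U : Type*} {E : Finset (V × U)} (e : E) : U := e.1.2

/-- The underlying simple graph on `V ⊕ U`. -/
def bipartiteGraph {V U : Type*} (E : Finset (V × U)) : SimpleGraph (V ⊕ U) :=
  SimpleGraph.fromRel (fun a b => ∃ e ∈ E, a = Sum.inl e.1 ∧ b = Sum.inr e.2)

/-- An embedding of the bipartite graph in the plane `ℂ`: distinct vertices are distinct points,
edges are simple arcs between their ends that contain no other vertex, and distinct edges meet
only in vertices. -/
structure PlaneEmbedding {V U : Type*} (E : Finset (V × U)) where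
  vert : V ⊕ U → ℂ
  vert_injective : Function.Injective vert
  arc : (e : E) → Path (vert (Sum.inl (genOf e))) (vert (Sum.inr (recOf e)))
  arc_injective : ∀ e, Function.Injective (arc e)
  arc_vert : ∀ e w s, arc e s = vert w → w = Sum.inl (genOf e) ∨ w = Sum.inr (recOf e)
  arc_arc : ∀ e e', e ≠ e' → ∀ s t, arc e s = arc e' t → arc e s ∈ Set.range vert

/-- A simple closed plane curve with an orientation and a starting point. -/
structure SimpleClosedCurve where
  start : ℂ
  path : Path start start
  simple : ∀ s t, path s = path t → s = t ∨ (s = 0 ∧ t = 1) ∨ (s = 1 ∧ t = 0)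

namespace SimpleClosedCurve

def carrier (C : SimpleClosedCurve) : Set ℂ := Set.range C.path

/-- Two points off the curve are on the same side if a path joins them off the curve. -/
def SameSide (C : SimpleClosedCurve) (a b : ℂ) : Prop := JoinedIn C.carrierᶜ a b

end SimpleClosedCurve

/-- `C` crosses the edge `e` once: it meets the edge in exactly one point, and the ends of the edge
are off the curve and on different sides of it. -/
def CrossesEdgeOnce {V U : Type*} {E : Finset (V × U)} (D : PlaneEmbedding E)
    (C : SimpleClosedCurve) (e : E) : Prop :=
  (∃! t : unitInterval, t ≠ 1 ∧ C.path t ∈ Set.range (D.arc e)) ∧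
  D.vert (Sum.inl (genOf e)) ∉ C.carrier ∧ D.vert (Sum.inr (recOf e)) ∉ C.carrier ∧
  ¬ C.SameSide (D.vert (Sum.inl (genOf e))) (D.vert (Sum.inr (recOf e)))

/-- `C` crosses every edge once.  For a connected graph this forces `C` to separate generators from
recognizers.  For a disconnected graph it does not, and there the generators of all edges are
required to lie on the same side of `C`. -/
structure IsCrossingCurve {V U : Type*} {E : Finset (V × U)} (D : PlaneEmbedding E)
    (C : SimpleClosedCurve) : Prop where
  crosses : ∀ e : E, CrossesEdgeOnce D C e
  sides : ¬ (bipartiteGraph E).Preconnected →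
    ∀ e e' : E, C.SameSide (D.vert (Sum.inl (genOf e))) (D.vert (Sum.inl (genOf e')))

/-- `A` lists the edges in the order in which `C`, run through once from its starting point,
meets them. -/
def IsCurveOrder {V U : Type*} {E : Finset (V × U)} (D : PlaneEmbedding E)
    (C : SimpleClosedCurve) {n : ℕ} (A : Fin n ≃ E) : Prop :=
  ∃ t : Fin n → unitInterval, StrictMono t ∧
    ∀ k, t k ≠ 1 ∧ C.path (t k) ∈ Set.range (D.arc (A k))

/-! ### Continuous logarithms and separation of the plane -/

/-! A topological and an algebraic half meet in `IsNonCrossingOrder`: edges at different vertices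
never alternate.

Topology. The generators of all edges lie on one side of `C`, the recognizers on the other. Suppose
that edges `a`, `a'` at one vertex and `b`, `b'` at another cross `C` alternately. The pieces of `a`
and `a'` up to `C` form a connected set `α`, whose two points on `C` split the curve into two arcs.
Neither arc together with `α` separates the ends of `b'`: the edge `b'` avoids one of these sets,
and a detour along `b` and then through the far side of `C` avoids the other. By Janiszewski's
theorem `C` does not separate the ends of `b'` either, a contradiction (`not_alternating`).
Janiszewski's theorem (`joinedIn_compl_union`) follows from Eilenberg's criterion: a compact `K`
does not separate `p` from `q` iff `(z - p) / (z - q)` has a continuous logarithm on `K`. Winding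
numbers also give the bound of two components for the complement of `C`.

Algebra. A vector with `v ∅ = 1` consists of sub-Pfaffians as soon as it satisfies the expansion
along the first row. At each vertex this expansion is the Grassmann–Plücker relation with `α` a
singleton. It passes to the product over all vertices when the order is non-crossing
(`satisfiesExpansion_prod`), since another block adds an even number to the exponent of a sign
unless its factor vanishes. This covers the grouped orders and the order of the curve alike. By
lexicographic minimality the two orders agree on the edges at each vertex, so the matrices
correspond under the permutation and the crossings are the same. Exchanging the two basis vectors
turns recognizers into generators. -/

theorem exists_continuous_exp_eq {X : Type*} [TopologicalSpace X] [SimplyConnectedSpace X]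
    [LocallyPathConnectedSpace X] {f : X → ℂ} (hf : Continuous f) (h0 : ∀ z, f z ≠ 0) :
    ∃ g : X → ℂ, Continuous g ∧ ∀ z, Complex.exp (g z) = f z := by
  obtain ⟨x₀⟩ : Nonempty X := inferInstance
  obtain ⟨F, ⟨-, hF⟩, -⟩ := Complex.isCoveringMapOn_exp.existsUnique_continuousMap_lifts
    ⟨f, hf⟩ (Complex.exp_log (h0 x₀)) h0
  exact ⟨F, F.continuous, fun z => congrFun hF z⟩

/-- Two continuous logarithms of the same function on a preconnected set differ by a constant. -/
theorem sub_eq_sub_of_exp_eq {X : Type*} [TopologicalSpace X] {s : Set X} (hs : IsPreconnected s)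
    {g h : X → ℂ} (hg : ContinuousOn g s) (hh : ContinuousOn h s)
    (heq : ∀ x ∈ s, Complex.exp (g x) = Complex.exp (h x)) {x y : X} (hx : x ∈ s) (hy : y ∈ s) :
    g x - h x = g y - h y := by
  have hpi : (2 * Real.pi * Complex.I : ℂ) ≠ 0 := Complex.two_pi_I_ne_zero
  have key : ∀ x ∈ s, ∃ n : ℤ, (g x - h x) / (2 * Real.pi * Complex.I) = n := by
    intro x hx
    obtain ⟨n, hn⟩ := Complex.exp_eq_exp_iff_exists_int.1 (heq x hx)
    exact ⟨n, by rw [hn]; field_simp; ring⟩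
  have hre : ContinuousOn (fun x => ((g x - h x) / (2 * Real.pi * Complex.I)).re) s :=
    Complex.continuous_re.comp_continuousOn ((hg.sub hh).div_const _)
  have hR : (fun x => ((g x - h x) / (2 * Real.pi * Complex.I)).re) x
      = (fun x => ((g x - h x) / (2 * Real.pi * Complex.I)).re) y := by
    refine hs.constant_of_mapsTo (T := Set.range ((↑) : ℤ → ℝ)) ?_ hre ?_ hx hy
    · exact ⟨Int.isClosedEmbedding_coe_real.isEmbedding.toHomeomorph.symm.isEmbedding
        |>.discreteTopology⟩
    · intro u hu
      obtain ⟨n, hn⟩ := key u hu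
      exact ⟨n, by simp [hn]⟩
  obtain ⟨n, hn⟩ := key x hx
  obtain ⟨m, hm⟩ := key y hy
  simp only [hn, hm, Complex.intCast_re, Int.cast_inj] at hR
  rw [hR, ← hm] at hn
  exact (div_left_inj' hpi).1 hn

/-- `f` has a continuous logarithm on `K`. -/
def HasLogOn (f : ℂ → ℂ) (K : Set ℂ) : Prop :=
  ∃ g : ℂ → ℂ, ContinuousOn g K ∧ ∀ z ∈ K, Complex.exp (g z) = f z

theorem HasLogOn.congr {f f' : ℂ → ℂ} {K : Set ℂ} (h : HasLogOn f K) (hf : ∀ z ∈ K, f z = f' z) :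
    HasLogOn f' K := by
  obtain ⟨g, hg, hgf⟩ := h
  exact ⟨g, hg, fun z hz => (hgf z hz).trans (hf z hz)⟩

theorem HasLogOn.mul {f f' : ℂ → ℂ} {K : Set ℂ} (h : HasLogOn f K) (h' : HasLogOn f' K) :
    HasLogOn (fun z => f z * f' z) K := by
  obtain ⟨g, hg, hgf⟩ := h
  obtain ⟨g', hg', hgf'⟩ := h'
  exact ⟨fun z => g z + g' z, hg.add hg', fun z hz => by
    rw [Complex.exp_add, hgf z hz, hgf' z hz]⟩

theorem HasLogOn.inv {f : ℂ → ℂ} {K : Set ℂ} (h : HasLogOn f K) :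
    HasLogOn (fun z => (f z)⁻¹) K := by
  obtain ⟨g, hg, hgf⟩ := h
  exact ⟨fun z => - g z, hg.neg, fun z hz => by rw [Complex.exp_neg, hgf z hz]⟩

/-- Continuous logarithms on two closed sets with preconnected intersection can be glued. -/
theorem HasLogOn.union {f : ℂ → ℂ} {K L : Set ℂ} (hK : IsClosed K) (hL : IsClosed L)
    (hKL : IsPreconnected (K ∩ L)) (h : HasLogOn f K) (h' : HasLogOn f L) :
    HasLogOn f (K ∪ L) := by
  classical
  obtain ⟨g, hg, hgf⟩ := h
  obtain ⟨g', hg', hgf'⟩ := h'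
  -- The two logarithms differ by a constant period on the overlap; shifting one of them by it makes
  -- them agree there.
  obtain ⟨c, hc, hcg⟩ : ∃ c : ℂ, Complex.exp c = 1 ∧ ∀ z ∈ K ∩ L, g z = g' z + c := by
    rcases (K ∩ L).eq_empty_or_nonempty with h0 | ⟨w, hw⟩
    · exact ⟨0, by simp, by simp [h0]⟩
    · refine ⟨g w - g' w, ?_, fun z hz => ?_⟩
      · rw [Complex.exp_sub, hgf w hw.1, hgf' w hw.2, div_self]
        rw [← hgf w hw.1]; exact Complex.exp_ne_zero _
      · rw [← sub_eq_sub_of_exp_eq hKL (hg.mono Set.inter_subset_left)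
          (hg'.mono Set.inter_subset_right)
          (fun x hx => (hgf x hx.1).trans (hgf' x hx.2).symm) hz hw]
        ring
  refine ⟨K.piecewise g (fun z => g' z + c), ContinuousOn.union_of_isClosed ?_ ?_ hK hL, ?_⟩
  · exact hg.congr fun z hz => Set.piecewise_eq_of_mem _ _ _ hz
  · refine (hg'.add continuousOn_const).congr (f := fun z => g' z + c) fun z hz => ?_
    by_cases hzK : z ∈ K
    · rw [Set.piecewise_eq_of_mem _ _ _ hzK, hcg z ⟨hzK, hz⟩]
    · rw [Set.piecewise_eq_of_notMem _ _ _ hzK]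
  · intro z hz
    by_cases hzK : z ∈ K
    · rw [Set.piecewise_eq_of_mem _ _ _ hzK, hgf z hzK]
    · rw [Set.piecewise_eq_of_notMem _ _ _ hzK, Complex.exp_add, hc, mul_one,
        hgf' z (hz.resolve_left hzK)]

/-- Having such a logarithm is a symmetric and transitive relation between points off `K`. It holds
locally: if `b` is closer to `a` than `K` is, then `(z - b) / (z - a)` stays within distance less
than 1 of 1, where the principal logarithm is continuous. Connectedness of the path does the rest.
-/
theorem hasLogOn_sub_div_sub_of_joinedIn {K : Set ℂ} (hK : IsClosed K) {p q : ℂ}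
    (h : JoinedIn Kᶜ p q) : HasLogOn (fun z => (z - p) / (z - q)) K := by
  obtain ⟨γ, hγ⟩ := h
  have hs : IsPreconnected (Set.range γ) := isPreconnected_range γ.continuous
  have hsub : ∀ x ∈ Set.range γ, x ∉ K := by rintro _ ⟨t, rfl⟩; exact hγ t
  have hne : ∀ x ∈ Set.range γ, ∀ z ∈ K, z - x ≠ 0 := fun x hx z hz h0 =>
    hsub x hx (by rwa [← sub_eq_zero.1 h0])
  refine hs.induction₂ (fun a b => HasLogOn (fun z => (z - a) / (z - b)) K) ?_ ?_ ?_
    ⟨0, γ.source⟩ ⟨1, γ.target⟩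
  · intro a ha
    rcases K.eq_empty_or_nonempty with rfl | hKne
    · exact Filter.Eventually.of_forall fun b => ⟨0, by simp, by simp⟩
    have hd : 0 < Metric.infDist a K := (hK.notMem_iff_infDist_pos hKne).1 (hsub a ha)
    filter_upwards [mem_nhdsWithin_of_mem_nhds (Metric.ball_mem_nhds a hd), self_mem_nhdsWithin]
      with b hb hbγ
    have hinv : HasLogOn (fun z => (z - b) / (z - a)) K := by
      have hslit : ∀ z ∈ K, (z - b) / (z - a) ∈ Complex.slitPlane := by
        intro z hz
        have hza := hne a ha z hz
        have h1 : ‖(a - b) / (z - a)‖ < 1 := by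
          rw [norm_div, div_lt_one (norm_pos_iff.2 hza), ← dist_eq_norm, ← dist_eq_norm]
          rw [Metric.mem_ball, dist_comm] at hb
          rw [dist_comm z a]
          exact hb.trans_le (Metric.infDist_le_dist_of_mem hz)
        have h2 : (z - b) / (z - a) = 1 + (a - b) / (z - a) := by field_simp; ring
        rw [h2]
        exact Complex.mem_slitPlane_of_norm_lt_one h1
      refine ⟨fun z => Complex.log ((z - b) / (z - a)), ?_, fun z hz => ?_⟩
      · refine ContinuousOn.clog ?_ hslit
        exact (continuousOn_id.sub continuousOn_const).div (continuousOn_id.sub continuousOn_const)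
          (hne a ha)
      · exact Complex.exp_log (Complex.slitPlane_ne_zero (hslit z hz))
    exact hinv.inv.congr fun z _ => by simp
  · intro a b c ha hb hc hab hbc
    refine (hab.mul hbc).congr fun z hz => ?_
    have := hne b hb z hz
    field_simp
  · intro a b ha hb hab
    exact hab.inv.congr fun z _ => by simp

/-- The argument principle behind the separation criterion: on the boundary of a bounded open set
that contains `p`, a non-zero power of `z - p` is not the product of an exponential and of a
function without zeros on the closure of the set. -/
theorem eq_zero_of_exp_mul_eq_zpow {K U : Set ℂ} (hK : IsClosed K) (hU : IsOpen U)
    (hUK : frontier U ⊆ K) (hUb : Bornology.IsBounded U) {p : ℂ} (hp : p ∈ U) {h g : ℂ → ℂ}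
    (hh : ContinuousOn h (closure U)) (h0 : ∀ z ∈ closure U, h z ≠ 0) (hg : ContinuousOn g K)
    {a : ℤ} (heq : ∀ z ∈ K, Complex.exp (g z) * h z = (z - p) ^ a) : a = 0 := by
  classical
  -- Tietze extension of `g` to the whole plane.
  obtain ⟨G, hG⟩ := ContinuousMap.exists_restrict_eq hK
    (⟨K.domRestrict g, continuousOn_iff_continuous_domRestrict.1 hg⟩ : C(K, ℂ))
  have hGg : ∀ z ∈ K, G z = g z := fun z hz => congrArg (fun F : C(K, ℂ) => F ⟨z, hz⟩) hG
  -- `R` has no zeros in the plane, hence a global continuous logarithm. On a circle around `U` it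
  -- equals `(z - p) ^ a`, whose logarithm grows by `2πia` in one turn, so `a = 0`.
  set R : ℂ → ℂ := U.piecewise (fun z => Complex.exp (G z) * h z) (fun z => (z - p) ^ a) with hRdef
  have hne : ∀ z ∈ Uᶜ, z - p ≠ 0 := fun z hz h => hz (by rwa [sub_eq_zero.1 h])
  have hR : Continuous R := by
    refine continuous_piecewise ?_ ?_ ?_
    · intro z hz
      rw [hGg z (hUK hz), heq z (hUK hz)]
    · exact (Complex.continuous_exp.comp G.continuous).continuousOn.mul hh
    · rw [hU.isClosed_compl.closure_eq]
      exact (continuousOn_id.sub continuousOn_const).zpow₀ a fun z hz => Or.inl (hne z hz)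
  have hR0 : ∀ z, R z ≠ 0 := by
    intro z
    by_cases hz : z ∈ U
    · rw [hRdef, Set.piecewise_eq_of_mem _ _ _ hz]
      exact mul_ne_zero (Complex.exp_ne_zero _) (h0 z (subset_closure hz))
    · rw [hRdef, Set.piecewise_eq_of_notMem _ _ _ hz]
      exact zpow_ne_zero _ (hne z hz)
  obtain ⟨L, hL, hLR⟩ := exists_continuous_exp_eq hR hR0
  obtain ⟨ρ, hρ, hUρ⟩ := hUb.subset_ball_lt 0 p
  have hcirc : ∀ θ : ℝ, Complex.exp (L (circleMap p ρ θ))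
      = Complex.exp (a * (Real.log ρ + θ * Complex.I)) := by
    intro θ
    have hout : circleMap p ρ θ ∉ U := fun hin => by
      have := hUρ hin
      rw [Metric.mem_ball, dist_eq_norm, circleMap_sub_center, norm_circleMap_zero,
        abs_of_pos hρ] at this
      exact this.false
    rw [hLR, hRdef, Set.piecewise_eq_of_notMem _ _ _ hout, circleMap_sub_center, circleMap_zero,
      Complex.exp_int_mul, Complex.exp_add, ← Complex.ofReal_exp, Real.exp_log hρ]
  have := sub_eq_sub_of_exp_eq (isPreconnected_univ (α := ℝ))
    (g := fun θ => L (circleMap p ρ θ)) (h := fun θ => a * (Real.log ρ + θ * Complex.I))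
    (hL.comp (continuous_circleMap p ρ)).continuousOn (by fun_prop) (fun θ _ => hcirc θ)
    (Set.mem_univ 0) (Set.mem_univ (2 * Real.pi))
  have hper : circleMap p ρ (2 * Real.pi) = circleMap p ρ 0 := by
    simpa using periodic_circleMap p ρ 0
  simp only [hper, sub_right_inj, Complex.ofReal_zero, zero_mul, add_zero] at this
  have h2 : (a : ℂ) * (2 * Real.pi * Complex.I) = 0 := by
    push_cast at this
    linear_combination -this
  simpa [Complex.two_pi_I_ne_zero] using h2

/-! ### Components of the complement of a closed set, and Eilenberg's criterion -/

theorem joinedIn_iff_mem_connectedComponentIn {O : Set ℂ} (hO : IsOpen O) {p q : ℂ} (hp : p ∈ O) :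
    JoinedIn O p q ↔ q ∈ connectedComponentIn O p := by
  constructor
  · rintro ⟨γ, hγ⟩
    exact (isPreconnected_range γ.continuous).subset_connectedComponentIn ⟨0, γ.source⟩
      (by rintro _ ⟨t, rfl⟩; exact hγ t) ⟨1, γ.target⟩
  · intro hq
    have hc : IsConnected (connectedComponentIn O p) := isConnected_connectedComponentIn_iff.2 hp
    exact ((hO.connectedComponentIn.isConnected_iff_isPathConnected.1 hc).joinedIn p
      (mem_connectedComponentIn hp) q hq).mono (connectedComponentIn_subset O p)

theorem frontier_connectedComponentIn_compl_subset {K : Set ℂ} (hK : IsClosed K) (p : ℂ) :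
    frontier (connectedComponentIn Kᶜ p) ⊆ K := by
  intro z hz
  by_contra hzK
  rw [hK.isOpen_compl.connectedComponentIn.frontier_eq] at hz
  obtain ⟨w, hw, hwp⟩ := mem_closure_iff.1 hz.1 _
    (hK.isOpen_compl.connectedComponentIn (x := z)) (mem_connectedComponentIn hzK)
  have h1 := connectedComponentIn_eq hw
  have h2 := connectedComponentIn_eq hwp
  exact hz.2 (by rw [h2, ← h1]; exact mem_connectedComponentIn hzK)

theorem isPreconnected_setOf_lt_norm (ρ : ℝ) : IsPreconnected {z : ℂ | ρ < ‖z‖} := by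
  have : {z : ℂ | ρ < ‖z‖} = (fun x : ℝ × ℝ => (x.1 : ℂ) * Complex.exp (x.2 * Complex.I)) ''
      (Set.Ioi ρ ×ˢ Set.univ) := by
    ext z
    constructor
    · intro hz
      exact ⟨(‖z‖, Complex.arg z), ⟨hz, Set.mem_univ _⟩, Complex.norm_mul_exp_arg_mul_I z⟩
    · rintro ⟨⟨r, θ⟩, ⟨hr, -⟩, rfl⟩
      have hr' : ρ < r := hr
      simpa [Complex.norm_exp_ofReal_mul_I] using hr'.trans_le (le_abs_self r)
  rw [this]
  exact ((convex_Ioi ρ).isPreconnected.prod isPreconnected_univ).image _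
    (Continuous.continuousOn (by fun_prop))

/-- The complement of a compact set has at most one unbounded component. -/
theorem joinedIn_of_not_isBounded {K : Set ℂ} (hK : IsCompact K) {p q : ℂ} (hp : p ∉ K)
    (hpb : ¬ Bornology.IsBounded (connectedComponentIn Kᶜ p))
    (hqb : ¬ Bornology.IsBounded (connectedComponentIn Kᶜ q)) : JoinedIn Kᶜ p q := by
  obtain ⟨ρ, hKρ⟩ := hK.isBounded.subset_closedBall 0
  have far : ∀ p, ¬ Bornology.IsBounded (connectedComponentIn Kᶜ p) →
      ∃ u ∈ connectedComponentIn Kᶜ p, ρ < ‖u‖ := by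
    intro p hp
    by_contra! hcon
    exact hp (Metric.isBounded_closedBall.subset fun u hu => mem_closedBall_zero_iff.2 (hcon u hu))
  obtain ⟨u, hu, hρu⟩ := far p hpb
  obtain ⟨v, hv, hρv⟩ := far q hqb
  have hvu : v ∈ connectedComponentIn Kᶜ u :=
    (isPreconnected_setOf_lt_norm ρ).subset_connectedComponentIn hρu
      (fun z hz hzK => (mem_closedBall_zero_iff.1 (hKρ hzK)).not_gt hz) hρv
  have hq : q ∈ Kᶜ := by
    by_contra hq
    rw [connectedComponentIn_eq_empty hq] at hv
    exact hv
  rw [joinedIn_iff_mem_connectedComponentIn hK.isClosed.isOpen_compl hp,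
    connectedComponentIn_eq hu, connectedComponentIn_eq hvu, ← connectedComponentIn_eq hv]
  exact mem_connectedComponentIn hq

/-- Taking the closure adds only points of `K` to the component of `p`. This supplies zero-free
functions for `eq_zero_of_exp_mul_eq_zpow`. -/
theorem sub_ne_zero_of_not_joinedIn {K : Set ℂ} (hK : IsClosed K) {p q : ℂ} (hp : p ∉ K)
    (hq : q ∉ K) (h : ¬ JoinedIn Kᶜ p q) :
    ∀ z ∈ closure (connectedComponentIn Kᶜ p), z - q ≠ 0 := by
  intro z hz h0
  rw [sub_eq_zero.1 h0] at hz
  rw [joinedIn_iff_mem_connectedComponentIn hK.isOpen_compl hp] at h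
  have := frontier_connectedComponentIn_compl_subset hK p
  rw [hK.isOpen_compl.connectedComponentIn.frontier_eq] at this
  exact hq (this ⟨hz, h⟩)

/-- If `(z - p) / (z - q)` has a continuous logarithm on a compact set, then that set does not
separate `p` from `q`. -/
theorem joinedIn_of_hasLogOn {K : Set ℂ} (hK : IsCompact K) {p q : ℂ} (hp : p ∉ K) (hq : q ∉ K)
    (h : HasLogOn (fun z => (z - p) / (z - q)) K) : JoinedIn Kᶜ p q := by
  -- If `q` is outside the bounded component of `p`, then `z - q` has no zero on its closure, and
  -- the argument principle with exponent 1 gives a contradiction.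
  have bounded : ∀ p q : ℂ, p ∉ K → q ∉ K → HasLogOn (fun z => (z - p) / (z - q)) K →
      Bornology.IsBounded (connectedComponentIn Kᶜ p) → JoinedIn Kᶜ p q := by
    intro p q hp hq h hb
    by_contra hj
    obtain ⟨g, hg, hgf⟩ := h
    refine one_ne_zero (α := ℤ) (eq_zero_of_exp_mul_eq_zpow hK.isClosed
      hK.isClosed.isOpen_compl.connectedComponentIn
      (frontier_connectedComponentIn_compl_subset hK.isClosed p) hb (mem_connectedComponentIn hp)
      (h := fun z => z - q) (by fun_prop) (sub_ne_zero_of_not_joinedIn hK.isClosed hp hq hj) hg ?_)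
    intro z hz
    have : z - q ≠ 0 := fun h0 => hq (by rwa [← sub_eq_zero.1 h0])
    rw [hgf z hz, zpow_one]
    field_simp
  by_cases hpb : Bornology.IsBounded (connectedComponentIn Kᶜ p)
  · exact bounded p q hp hq h hpb
  by_cases hqb : Bornology.IsBounded (connectedComponentIn Kᶜ q)
  · exact (bounded q p hq hp (h.inv.congr fun z _ => by simp) hqb).symm
  · exact joinedIn_of_not_isBounded hK hp hpb hqb

/-- **Janiszewski's theorem**: if neither of two compact sets with preconnected intersection
separates `p` from `q`, then neither does their union. -/
theorem joinedIn_compl_union {K L : Set ℂ} (hK : IsCompact K) (hL : IsCompact L)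
    (hKL : IsPreconnected (K ∩ L)) {p q : ℂ} (hjK : JoinedIn Kᶜ p q) (hjL : JoinedIn Lᶜ p q) :
    JoinedIn (K ∪ L)ᶜ p q :=
  joinedIn_of_hasLogOn (hK.union hL)
    (fun hp => hp.elim hjK.source_mem hjL.source_mem)
    (fun hq => hq.elim hjK.target_mem hjL.target_mem)
    ((hasLogOn_sub_div_sub_of_joinedIn hK.isClosed hjK).union hK.isClosed hL.isClosed hKL
      (hasLogOn_sub_div_sub_of_joinedIn hL.isClosed hjL))

/-! ### Simple closed curves -/

namespace SimpleClosedCurve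

variable (C : SimpleClosedCurve)

theorem isCompact_carrier : IsCompact C.carrier := isCompact_range C.path.continuous

theorem sameSide_of_isPreconnected {s : Set ℂ} (hs : IsPreconnected s) (hsC : Disjoint s C.carrier)
    {p q : ℂ} (hp : p ∈ s) (hq : q ∈ s) : C.SameSide p q :=
  (joinedIn_iff_mem_connectedComponentIn C.isCompact_carrier.isClosed.isOpen_compl
    (hsC.subset_compl_right hp)).2 (hs.subset_connectedComponentIn hp hsC.subset_compl_right hq)

/-- A continuous function on the parameter interval with equal end values descends to the curve. -/
theorem exists_continuousOn_comp_path {l : unitInterval → ℂ} (hl : Continuous l)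
    (h01 : l 0 = l 1) : ∃ g : ℂ → ℂ, ContinuousOn g C.carrier ∧ ∀ t, g (C.path t) = l t := by
  have hfac : ∀ s t, C.path s = C.path t → l s = l t := by
    intro s t hst
    rcases C.simple s t hst with rfl | ⟨rfl, rfl⟩ | ⟨rfl, rfl⟩
    exacts [rfl, h01, h01.symm]
  have hg : ∀ t, Function.extend C.path l 0 (C.path t) = l t := fun t =>
    Function.FactorsThrough.extend_apply (fun s t hst => hfac s t hst) 0 t
  refine ⟨Function.extend C.path l 0, ?_, hg⟩
  -- A continuous map from a compact space to a Hausdorff space is closed, so the parametrization is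
  -- a quotient map onto the curve.
  have hq : Topology.IsQuotientMap (Set.rangeFactorization C.path) :=
    (C.path.continuous.subtype_mk _).isClosedMap.isQuotientMap (C.path.continuous.subtype_mk _)
      Set.rangeFactorization_surjective
  refine continuousOn_iff_continuous_domRestrict.2 (hq.continuous_iff.2 ?_)
  convert hl using 1
  ext t
  exact hg t

/-- The logarithm of a function without zeros along the curve, and its winding number. -/
theorem exists_log_comp_path {f : ℂ → ℂ} (hf : ContinuousOn f C.carrier)
    (h0 : ∀ z ∈ C.carrier, f z ≠ 0) : ∃ (l : unitInterval → ℂ) (d : ℤ), Continuous l ∧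
      (∀ t, Complex.exp (l t) = f (C.path t)) ∧ l 1 - l 0 = d * (2 * Real.pi * Complex.I) := by
  -- The path is extended by constants to the simply connected line `ℝ`, where logarithms lift.
  obtain ⟨l, hl, hlf⟩ := exists_continuous_exp_eq (f := fun x : ℝ => f (C.path.extend x))
    (hf.comp_continuous C.path.continuous_extend fun x => by
      rw [carrier, ← C.path.extend_range]; exact ⟨x, rfl⟩)
    (fun x => h0 _ (by rw [carrier, ← C.path.extend_range]; exact ⟨x, rfl⟩))
  have hlt : ∀ t : unitInterval, Complex.exp (l t) = f (C.path t) := fun t => by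
    rw [hlf, C.path.extend_apply t.2]
  have : Complex.exp (l (1 : unitInterval)) = Complex.exp (l (0 : unitInterval)) := by
    rw [hlt, hlt, C.path.source, C.path.target]
  obtain ⟨d, hd⟩ := Complex.exp_eq_exp_iff_exists_int.1 this
  exact ⟨fun t => l t, d, hl.comp continuous_subtype_val, hlt, by simp only [hd]; ring⟩

/-- The complement of a simple closed curve has at most two components. -/
theorem sameSide_of_not_of_not {p q r : ℂ} (hp : p ∉ C.carrier) (hq : q ∉ C.carrier)
    (hr : r ∉ C.carrier) (hpr : ¬ C.SameSide p r) (hqr : ¬ C.SameSide q r) : C.SameSide p q := by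
  by_contra hpq
  have hK := C.isCompact_carrier
  wlog hb : Bornology.IsBounded (connectedComponentIn C.carrierᶜ p) generalizing p q
  · by_cases hqb : Bornology.IsBounded (connectedComponentIn C.carrierᶜ q)
    · exact this hq hp hqr hpr (fun h => hpq h.symm) hqb
    · exact hpq (joinedIn_of_not_isBounded hK hp hb hqb)
  have hne : ∀ {p}, p ∉ C.carrier → ∀ z ∈ C.carrier, z - p ≠ 0 := fun hp z hz h0 =>
    hp (by rwa [← sub_eq_zero.1 h0])
  have hcont : ∀ p, ContinuousOn (fun z => (z - p) / (z - r)) C.carrier := fun p =>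
    ContinuousOn.div (by fun_prop) (by fun_prop) (hne hr)
  obtain ⟨l, d, hl, hlf, hld⟩ := C.exists_log_comp_path (hcont p)
    fun z hz => div_ne_zero (hne hp z hz) (hne hr z hz)
  obtain ⟨m, e, hm, hmf, hme⟩ := C.exists_log_comp_path (hcont q)
    fun z hz => div_ne_zero (hne hq z hz) (hne hr z hz)
  -- Here `d` and `e` are the winding numbers for `p` and `q` relative to `r`. If `e = 0`, the
  -- logarithm closes up on the curve and `q` is joined to `r`.
  by_cases he : e = 0
  · obtain ⟨g, hg, hgm⟩ := C.exists_continuousOn_comp_path hm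
      (by rw [he, Int.cast_zero, zero_mul, sub_eq_zero] at hme; exact hme.symm)
    refine hqr (joinedIn_of_hasLogOn hK hq hr ⟨g, hg, ?_⟩)
    rintro _ ⟨t, rfl⟩
    rw [hgm, hmf]
  -- The combination `e * l - d * m` has winding number 0. It writes `(z - p) ^ e` as an exponential
  -- times powers of `z - q` and `z - r`, which have no zeros on the closed component of `p`; this
  -- forces `e = 0`.
  · obtain ⟨g, hg, hgl⟩ := C.exists_continuousOn_comp_path
      (l := fun t => e * l t - d * m t) (by fun_prop)
      (by linear_combination (-e : ℂ) * hld + (d : ℂ) * hme)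
    refine he (eq_zero_of_exp_mul_eq_zpow hK.isClosed
      hK.isClosed.isOpen_compl.connectedComponentIn
      (frontier_connectedComponentIn_compl_subset hK.isClosed p) hb (mem_connectedComponentIn hp)
      (h := fun z => (z - q) ^ d * (z - r) ^ (e - d)) ?_ ?_ hg ?_)
    · refine ContinuousOn.mul ?_ ?_
      · exact ContinuousOn.zpow₀ (by fun_prop) d fun z hz =>
          Or.inl (sub_ne_zero_of_not_joinedIn hK.isClosed hp hq hpq z hz)
      · exact ContinuousOn.zpow₀ (by fun_prop) _ fun z hz =>
          Or.inl (sub_ne_zero_of_not_joinedIn hK.isClosed hp hr hpr z hz)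
    · intro z hz
      exact mul_ne_zero (zpow_ne_zero _ (sub_ne_zero_of_not_joinedIn hK.isClosed hp hq hpq z hz))
        (zpow_ne_zero _ (sub_ne_zero_of_not_joinedIn hK.isClosed hp hr hpr z hz))
    · rintro _ ⟨t, rfl⟩
      have h1 := hne hp _ ⟨t, rfl⟩
      have h2 := hne hq _ ⟨t, rfl⟩
      have h3 := hne hr _ ⟨t, rfl⟩
      rw [hgl, Complex.exp_sub, Complex.exp_int_mul, Complex.exp_int_mul, hlf, hmf, div_zpow,
        div_zpow, zpow_sub₀ h3]
      field_simp

/-- A connected set `α` that meets the curve at the parameters `t₁ < t₃` and, together with either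
of the two arcs between them, does not separate `p` from `q`, does not do so together with the
whole curve. -/
theorem joinedIn_compl_carrier_union {α : Set ℂ} (hα : IsCompact α) (hαc : IsPreconnected α)
    {t₁ t₃ : unitInterval} (ht₃ : t₃ ≠ 1) (h1 : C.path t₁ ∈ α)
    (h3 : C.path t₃ ∈ α) {p q : ℂ} (hin : JoinedIn (C.path '' Set.Icc t₁ t₃ ∪ α)ᶜ p q)
    (hout : JoinedIn (C.path '' (Set.Iic t₁ ∪ Set.Ici t₃) ∪ α)ᶜ p q) : C.SameSide p q := by
  have hcl : ∀ s : Set unitInterval, IsClosed s → IsCompact (C.path '' s ∪ α) := fun s hs =>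
    (hs.isCompact.image C.path.continuous).union hα
  -- The two arcs share only the points at `t₁` and `t₃`, which lie in `α`. The identification of
  -- the parameters 0 and 1 adds nothing, because `t₃ ≠ 1`.
  have hcap : (C.path '' Set.Icc t₁ t₃ ∪ α) ∩ (C.path '' (Set.Iic t₁ ∪ Set.Ici t₃) ∪ α) = α := by
    rw [← Set.inter_union_distrib_right, Set.union_eq_right]
    rintro _ ⟨⟨s, ⟨hs1, hs3⟩, rfl⟩, ⟨t, ht, hts⟩⟩
    rcases C.simple t s hts with rfl | ⟨rfl, rfl⟩ | ⟨rfl, rfl⟩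
    · rcases ht with ht | ht
      · rwa [le_antisymm ht hs1]
      · rwa [← le_antisymm ht hs3]
    · exact absurd (le_antisymm unitInterval.le_one' hs3) ht₃
    · rwa [← le_antisymm hs1 unitInterval.nonneg']
  refine (joinedIn_compl_union (hcl _ isClosed_Icc) (hcl _ (isClosed_Iic.union isClosed_Ici))
    (by rwa [hcap]) hin hout).mono (Set.compl_subset_compl.2 ?_)
  rintro _ ⟨t, rfl⟩
  rcases le_total t t₁ with h | h
  · exact Or.inr (Or.inl ⟨t, Or.inl h, rfl⟩)
  · rcases le_total t t₃ with ht | ht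
    · exact Or.inl (Or.inl ⟨t, ⟨h, ht⟩, rfl⟩)
    · exact Or.inr (Or.inl ⟨t, Or.inr ht, rfl⟩)

/-- Two arcs from `x` and two arcs from `y ≠ x` that cross the curve once each, from the same side
to the other one, do not cross it alternately. -/
theorem not_alternating {ε : Type*} (arc : ε → unitInterval → ℂ) (hcont : ∀ e, Continuous (arc e))
    (hinj : ∀ e, Function.Injective (arc e))
    (hdisj : ∀ e e', e ≠ e' → ∀ s t, arc e s = arc e' t → (s = 0 ∧ t = 0) ∨ (s = 1 ∧ t = 1))
    (τ : ε → unitInterval) (hτ1 : ∀ e, τ e ≠ 1) (hτ : ∀ e, C.path (τ e) ∈ Set.range (arc e))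
    (huniq : ∀ e t, t ≠ 1 → C.path t ∈ Set.range (arc e) → t = τ e)
    (h0 : ∀ e, arc e 0 ∉ C.carrier) (h1 : ∀ e, arc e 1 ∉ C.carrier)
    (hsides : ∀ e, ¬ C.SameSide (arc e 0) (arc e 1))
    (hsame : ∀ e e', C.SameSide (arc e 0) (arc e' 0))
    {a b a' b' : ε} (ha : arc a 0 = arc a' 0) (hb : arc b 0 = arc b' 0) (hab : arc a 0 ≠ arc b 0)
    (hlt₁ : τ a < τ b) (hlt₂ : τ b < τ a') (hlt₃ : τ a' < τ b') : False := by
  choose σ hσ using hτ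
  have hσ1 : ∀ e, σ e ≠ 1 := fun e h => h1 e (by rw [← h, hσ]; exact ⟨_, rfl⟩)
  -- The parameter 1 repeats the starting point, so it is replaced by 0 before uniqueness is used.
  have hmeet : ∀ e s t, arc e s = C.path t → s = σ e ∧ C.path t = C.path (τ e) := by
    intro e s t hst
    have : C.path t = C.path (τ e) := by
      by_cases ht : t = 1
      · have h00 : C.path t = C.path 0 := by rw [ht, C.path.source, C.path.target]
        rw [h00, ← huniq e 0 (by simp) ⟨s, by rw [hst, h00]⟩]
      · rw [← huniq e t ht ⟨s, hst⟩]
    exact ⟨hinj e (by rw [hst, this, hσ]), this⟩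
  set α : Set ℂ := arc a '' Set.Iic (σ a) ∪ arc a' '' Set.Iic (σ a') with hα
  have hαcomp : IsCompact α := (isClosed_Iic.isCompact.image (hcont a)).union
    (isClosed_Iic.isCompact.image (hcont a'))
  have hαconn : IsPreconnected α := by
    refine IsPreconnected.union (arc a 0) ⟨0, unitInterval.nonneg', rfl⟩
      ⟨0, unitInterval.nonneg', ha.symm⟩ ?_ ?_
    · exact isPreconnected_Iic.image _ (hcont a).continuousOn
    · exact isPreconnected_Iic.image _ (hcont a').continuousOn
  have hside : ∀ e s, s < σ e → C.SameSide (arc e 0) (arc e s) := by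
    intro e s hs
    refine C.sameSide_of_isPreconnected (isPreconnected_Iic.image (arc e) (hcont e).continuousOn)
      (Set.disjoint_left.2 ?_) ⟨0, unitInterval.nonneg', rfl⟩ ⟨s, Set.mem_Iic.2 le_rfl, rfl⟩
    rintro _ ⟨u, hu, rfl⟩ ⟨t, ht⟩
    exact (lt_of_le_of_lt (Set.mem_Iic.1 hu) hs).ne (hmeet e u t ht.symm).1
  have hne : ∀ {d e : ε}, arc d 0 ≠ arc e 0 → ∀ s t, s ≠ 1 → arc d s ≠ arc e t := by
    intro d e hde s t hs heq
    rcases hdisj d e (fun h => hde (by rw [h])) s t heq with ⟨rfl, rfl⟩ | ⟨h, -⟩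
    exacts [hde heq, hs h]
  have hlt1 : ∀ e s, s ≤ σ e → s ≠ 1 := fun e s hs h =>
    hσ1 e (le_antisymm unitInterval.le_one' (h ▸ hs))
  have hα_arc : ∀ e, arc a 0 ≠ arc e 0 → ∀ t, arc e t ∉ α := by
    rintro e hae t (⟨s, hs, hst⟩ | ⟨s, hs, hst⟩)
    · exact hne hae s t (hlt1 a s hs) hst
    · exact hne (ha ▸ hae) s t (hlt1 a' s hs) hst
  -- Off the curve, `α` stays on the initial side, so paths on the far side avoid it.
  have hαside : ∀ z ∈ α, z ∉ C.carrier → C.SameSide (arc a 0) z := by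
    rintro z (⟨s, hs, rfl⟩ | ⟨s, hs, rfl⟩) hz
    · exact hside a s (lt_of_le_of_ne hs fun h => hz (by rw [h, hσ]; exact ⟨_, rfl⟩))
    · rw [ha]
      exact hside a' s (lt_of_le_of_ne hs fun h => hz (by rw [h, hσ]; exact ⟨_, rfl⟩))
  have hpath : ∀ e, arc a 0 ≠ arc e 0 → ∀ s : Set unitInterval, C.path (τ e) ∉ C.path '' s →
      JoinedIn (C.path '' s ∪ α)ᶜ (arc e 0) (arc e 1) := by
    intro e hae s hs
    refine ⟨⟨⟨arc e, hcont e⟩, rfl, rfl⟩, ?_⟩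
    rintro t (⟨u, hu, hut⟩ | ht)
    · exact hs ((hmeet e t u hut.symm).2 ▸ ⟨u, hu, rfl⟩)
    · exact hα_arc e hae t ht
  -- The far ends of `b` and `b'` are on the same side because there are at most two sides.
  have hba' : JoinedIn (C.carrier ∪ α)ᶜ (arc b 1) (arc b' 1) := by
    have hbb : C.SameSide (arc b 1) (arc b' 1) :=
      C.sameSide_of_not_of_not (h1 b) (h1 b') (h0 b) (fun h => hsides b h.symm)
        (fun h => hsides b' (hb ▸ h.symm))
    obtain ⟨γ, hγ⟩ := hbb
    refine ⟨γ, ?_⟩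
    rintro t (ht | ht)
    · exact hγ t ht
    · have : C.SameSide (arc b 1) (γ t) :=
        C.sameSide_of_isPreconnected (isPreconnected_range γ.continuous)
          (Set.disjoint_left.2 (by rintro _ ⟨u, rfl⟩; exact hγ u)) ⟨0, γ.source⟩ ⟨t, rfl⟩
      exact hsides b ((hsame b a).trans ((hαside _ ht (hγ t)).trans this.symm))
  -- `b'` crosses `C` outside `[τ a, τ a']`, so it avoids the inner arc. `b` crosses inside, so `b`
  -- followed by the far-side path avoids the outer arc.
  refine hsides b' (C.joinedIn_compl_carrier_union hαcomp hαconn (hτ1 a')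
    (Or.inl ⟨σ a, Set.mem_Iic.2 le_rfl, hσ a⟩) (Or.inr ⟨σ a', Set.mem_Iic.2 le_rfl, hσ a'⟩)
    (hpath b' (hb ▸ hab) _ ?_) ?_)
  · rintro ⟨s, ⟨hs1, hs3⟩, hs⟩
    rcases C.simple s (τ b') hs with rfl | ⟨rfl, h⟩ | ⟨rfl, h⟩
    · exact hs3.not_gt hlt₃
    · exact hτ1 b' h
    · exact hτ1 a' (le_antisymm unitInterval.le_one' hs3)
  · rw [← hb]
    refine (hpath b hab _ ?_).trans (hba'.mono (Set.compl_subset_compl.2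
      (Set.union_subset_union_left _ (Set.image_subset_range _ _))))
    rintro ⟨s, hs13, hs⟩
    rcases C.simple s (τ b) hs with rfl | ⟨rfl, h⟩ | ⟨rfl, h⟩
    · rcases hs13 with h | h
      · exact (h : _ ≤ _).not_gt hlt₁
      · exact (h : _ ≤ _).not_gt hlt₂
    · exact hτ1 b h
    · exact (h ▸ hlt₁).not_ge unitInterval.nonneg'

end SimpleClosedCurve

/-! ### Non-crossing edge orders -/

/-- Edges with different ends do not alternate in the order `A`. -/
def IsNonCrossingOrder {n : ℕ} {ε W : Type*} (f : ε → W) (A : Fin n ≃ ε) : Prop :=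
  ∀ i j k l : Fin n, i < j → j < k → k < l → f (A i) = f (A k) → f (A j) = f (A l) →
    f (A i) = f (A j)

theorem IsGroupedOrder.isNonCrossingOrder {n : ℕ} {ε W : Type*} {f : ε → W} {A : Fin n ≃ ε}
    (h : IsGroupedOrder f A) : IsNonCrossingOrder f A :=
  fun i j k _ hij hjk _ hik _ => (h i j k hij hjk hik).symm

/-- The lexicographically minimal grouped order lists the edges with the same end in their given
order. -/
theorem IsLexMinGroupedOrder.lt_iff_lt {n : ℕ} {ε W : Type*} {f : ε → W} {A B : Fin n ≃ ε}
    (h : IsLexMinGroupedOrder f B A) {e e' : ε} (hee : f e = f e') :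
    A.symm e < A.symm e' ↔ B.symm e < B.symm e' := by
  have mono : ∀ i j, i < j → f (A i) = f (A j) → B.symm (A i) < B.symm (A j) := by
    intro i j hij hf
    by_contra hlt
    have hlt' : B.symm (A j) < B.symm (A i) :=
      lt_of_le_of_ne (not_lt.1 hlt) fun heq => hij.ne' (A.injective (B.symm.injective heq))
    have hfswap : ∀ k, f (A (Equiv.swap i j k)) = f (A k) := by
      intro k
      by_cases hki : k = i
      · rw [hki, Equiv.swap_apply_left, hf]
      · by_cases hkj : k = j
        · rw [hkj, Equiv.swap_apply_right, hf]
        · rw [Equiv.swap_apply_of_ne_of_ne hki hkj]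
    have hgr : IsGroupedOrder f ((Equiv.swap i j).trans A) := by
      intro a b c hab hbc hac
      simp only [Equiv.trans_apply, hfswap] at hac ⊢
      exact h.1 a b c hab hbc hac
    -- Exchanging two edges with the same end keeps the order grouped; the new word agrees before
    -- `i` and is smaller at `i`.
    refine (h.2 _ hgr).not_gt ⟨i, fun k hk => ?_, ?_⟩
    · simp [orderPerm, Equiv.swap_apply_of_ne_of_ne hk.ne (hk.trans hij).ne]
    · simpa [orderPerm] using hlt'
  constructor
  · intro hlt
    simpa using mono _ _ hlt (by simpa using hee)
  · intro hlt
    by_contra hnot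
    rcases (not_lt.1 hnot).lt_or_eq with h1 | h1
    · exact (mono _ _ h1 (by simpa using hee.symm)).not_gt (by simpa using hlt)
    · exact hlt.ne (by rw [A.symm.injective h1])

theorem crosses_iff_of_lt_iff {n : ℕ} {ε W : Type*} [DecidableEq ε] {f : ε → W} {A B : Fin n ≃ ε}
    (h : ∀ e e', f e = f e' → (A.symm e < A.symm e' ↔ B.symm e < B.symm e')) {p q : Finset ε}
    {w : W} (hp : ∀ e ∈ p, f e = w) (hq : ∀ e ∈ q, f e = w) : Crosses A p q ↔ Crosses B p q := by
  refine exists_congr fun a => exists_congr fun b => exists_congr fun a' => exists_congr fun b' =>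
    and_congr_right ?_
  rintro rfl
  refine and_congr_right ?_
  rintro rfl
  simp only [Finset.mem_insert, Finset.mem_singleton, forall_eq_or_imp, forall_eq] at hp hq
  rw [h a b (by rw [hp.1, hq.1]), h b a' (by rw [hp.2, hq.1]), h a' b' (by rw [hp.2, hq.2])]

/-- Pairs that cross in `B` alternate, so they belong to the same vertex; and at one vertex `A` and
`B` order the edges alike. -/
theorem crossingNumber_eq_sum_of_isNonCrossingOrder {n : ℕ} {ε W : Type*} [DecidableEq ε]
    [Fintype W] [DecidableEq W] {f : ε → W} {A B : Fin n ≃ ε} (hB : IsNonCrossingOrder f B)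
    (h : ∀ e e', f e = f e' → (A.symm e < A.symm e' ↔ B.symm e < B.symm e'))
    {I : Finset ε} {S : Finset (Finset ε)} (hS : IsPairingAlong f I S) :
    crossingNumber B S = ∑ w, crossingNumber A (pairingAt f w S) := by
  classical
  unfold crossingNumber
  rw [← Finset.card_biUnion]
  · congr 1
    ext ⟨p, q⟩
    simp only [Finset.mem_filter, Finset.mem_product, Finset.mem_biUnion, Finset.mem_univ,
      true_and, pairingAt]
    constructor
    · rintro ⟨⟨hp, hq⟩, hc⟩
      obtain ⟨wp, hwp⟩ := hS.2 p hp
      obtain ⟨wq, hwq⟩ := hS.2 q hq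
      have hw : wp = wq := by
        obtain ⟨a, b, a', b', rfl, rfl, h1, h2, h3⟩ := hc
        have := hB _ _ _ _ h1 h2 h3
        simp only [Equiv.apply_symm_apply] at this
        rw [hwp a (by simp), hwp a' (by simp), hwq b (by simp), hwq b' (by simp)] at this
        exact this rfl rfl
      subst hw
      exact ⟨wp, ⟨⟨hp, hwp⟩, hq, hwq⟩, (crosses_iff_of_lt_iff h hwp hwq).2 hc⟩
    · rintro ⟨w, ⟨⟨hp, hwp⟩, hq, hwq⟩, hc⟩
      exact ⟨⟨hp, hq⟩, (crosses_iff_of_lt_iff h hwp hwq).1 hc⟩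
  · intro w _ w' _ hww
    refine Finset.disjoint_left.2 ?_
    rintro ⟨p, q⟩ h1 h2
    simp only [Finset.mem_filter, Finset.mem_product, pairingAt] at h1 h2
    obtain ⟨a, b, a', b', rfl, -⟩ := h1.2
    exact hww ((h1.1.1.2 a (by simp)).symm.trans (h2.1.1.2 a (by simp)))

/-! ### Crossing curves give non-crossing orders -/

section Plane

variable {V U : Type*} {E : Finset (V × U)} {D : PlaneEmbedding E} {C : SimpleClosedCurve}

/-- All arcs run from generator to recognizer, so a common vertex is the start of both arcs or the
end of both. -/
theorem PlaneEmbedding.eq_zero_or_eq_one (D : PlaneEmbedding E) {e e' : E} (hee : e ≠ e')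
    {s t : unitInterval} (h : D.arc e s = D.arc e' t) : (s = 0 ∧ t = 0) ∨ (s = 1 ∧ t = 1) := by
  obtain ⟨w, hw⟩ := D.arc_arc e e' hee s t h
  have genEnd : ∀ e s, D.arc e s = D.vert (Sum.inl (genOf e)) → s = 0 := fun e s hs =>
    D.arc_injective e (by rw [hs, (D.arc e).source])
  have recEnd : ∀ e s, D.arc e s = D.vert (Sum.inr (recOf e)) → s = 1 := fun e s hs =>
    D.arc_injective e (by rw [hs, (D.arc e).target])
  rcases D.arc_vert e w s hw.symm with rfl | rfl <;>
    rcases D.arc_vert e' _ t (h ▸ hw.symm) with h' | h'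
  · exact Or.inl ⟨genEnd e s hw.symm, genEnd e' t (by rw [← h, ← hw, h'])⟩
  · cases h'
  · cases h'
  · exact Or.inr ⟨recEnd e s hw.symm, recEnd e' t (by rw [← h, ← hw, h'])⟩

theorem IsCrossingCurve.sameSide_genOf (hC : IsCrossingCurve D C) (e e' : E) :
    C.SameSide (D.vert (Sum.inl (genOf e))) (D.vert (Sum.inl (genOf e'))) := by
  by_cases hconn : (bipartiteGraph E).Preconnected
  swap
  · exact hC.sides hconn e e'
  obtain ⟨-, he, -, -⟩ := hC.crosses e
  -- Each edge changes sides and there are only two, so `P` propagates along walks.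
  let P : V ⊕ U → Prop := Sum.elim
    (fun x => C.SameSide (D.vert (Sum.inl (genOf e))) (D.vert (Sum.inl x)))
    (fun c => ¬ C.SameSide (D.vert (Sum.inl (genOf e))) (D.vert (Sum.inr c)))
  have step : ∀ v w, (bipartiteGraph E).Adj v w → P v → P w := by
    intro v w hvw hv
    rw [bipartiteGraph, SimpleGraph.fromRel_adj] at hvw
    obtain ⟨-, ⟨d, hd, rfl, rfl⟩ | ⟨d, hd, rfl, rfl⟩⟩ := hvw
    · obtain ⟨-, -, -, hs⟩ := hC.crosses ⟨d, hd⟩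
      exact fun h => hs (hv.symm.trans h)
    · obtain ⟨-, hg, hr, hs⟩ := hC.crosses ⟨d, hd⟩
      exact C.sameSide_of_not_of_not he hg hr hv hs
  have walk : ∀ v w, (bipartiteGraph E).Walk v w → P v → P w := by
    intro v w p
    induction p with
    | nil => exact id
    | cons hadj _ ih => exact fun hv => ih (step _ _ hadj hv)
  obtain ⟨p⟩ := hconn (Sum.inl (genOf e)) (Sum.inl (genOf e'))
  exact walk _ _ p (JoinedIn.refl he)

theorem IsCrossingCurve.sameSide_recOf (hC : IsCrossingCurve D C) (e e' : E) :
    C.SameSide (D.vert (Sum.inr (recOf e))) (D.vert (Sum.inr (recOf e'))) := by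
  obtain ⟨-, hg, hr, hs⟩ := hC.crosses e
  obtain ⟨-, -, hr', hs'⟩ := hC.crosses e'
  exact C.sameSide_of_not_of_not hr hr' hg (fun h => hs h.symm)
    (fun h => hs' ((hC.sameSide_genOf e' e).trans h.symm))

theorem IsCurveOrder.exists_parameter {n : ℕ} {A : Fin n ≃ E} (hA : IsCurveOrder D C A) :
    ∃ τ : E → unitInterval, (∀ i j, i < j → τ (A i) < τ (A j)) ∧ (∀ e, τ e ≠ 1) ∧
      ∀ e, C.path (τ e) ∈ Set.range (D.arc e) := by
  obtain ⟨t, ht, htA⟩ := hA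
  refine ⟨fun e => t (A.symm e), fun i j hij => by simpa using ht hij, fun e => (htA _).1,
    fun e => ?_⟩
  have := (htA (A.symm e)).2
  rwa [A.apply_symm_apply] at this

theorem IsCrossingCurve.isNonCrossingOrder_genOf (hC : IsCrossingCurve D C) {n : ℕ}
    {A : Fin n ≃ E} (hA : IsCurveOrder D C A) : IsNonCrossingOrder genOf A := by
  obtain ⟨τ, hτ, hτ1, hτA⟩ := hA.exists_parameter
  intro i j k l hij hjk hkl hik hjl
  by_contra hne
  refine C.not_alternating (fun e s => D.arc e s) (fun e => (D.arc e).continuous) D.arc_injective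
    (fun e e' hee s t h => D.eq_zero_or_eq_one hee h) τ
    hτ1 hτA ?_ ?_ ?_ ?_ ?_
    (a := A i) (b := A j) (a' := A k) (b' := A l) (by simp [hik]) (by simp [hjl]) ?_
    (hτ _ _ hij) (hτ _ _ hjk) (hτ _ _ hkl)
  · intro e t ht hte
    exact (hC.crosses e).1.unique ⟨ht, hte⟩ ⟨hτ1 e, hτA e⟩
  · intro e; simpa using (hC.crosses e).2.1
  · intro e; simpa using (hC.crosses e).2.2.1
  · intro e; simpa using (hC.crosses e).2.2.2
  · intro e e'; simpa using hC.sameSide_genOf e e'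
  · simpa using fun h => hne (Sum.inl.inj (D.vert_injective h))

theorem IsCrossingCurve.isNonCrossingOrder_recOf (hC : IsCrossingCurve D C) {n : ℕ}
    {A : Fin n ≃ E} (hA : IsCurveOrder D C A) : IsNonCrossingOrder recOf A := by
  obtain ⟨τ, hτ, hτ1, hτA⟩ := hA.exists_parameter
  intro i j k l hij hjk hkl hik hjl
  by_contra hne
  have hrange : ∀ e, Set.range (D.arc e).symm = Set.range (D.arc e) := fun e =>
    (D.arc e).symm_range
  -- Reversed arcs start at the recognizers.
  refine C.not_alternating (fun e s => (D.arc e).symm s) (fun e => (D.arc e).symm.continuous)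
    (fun e s t h => unitInterval.symm_bijective.injective (D.arc_injective e h))
    (fun e e' hee s t h => ?_) τ
    hτ1 (fun e => (hrange e).symm ▸ hτA e) ?_ ?_ ?_ ?_ ?_
    (a := A i) (b := A j) (a' := A k) (b' := A l) (by simp [hik]) (by simp [hjl]) ?_
    (hτ _ _ hij) (hτ _ _ hjk) (hτ _ _ hkl)
  · have := D.eq_zero_or_eq_one hee h
    simpa [unitInterval.symm_eq_zero, unitInterval.symm_eq_one, or_comm] using this
  · intro e t ht hte
    have hte' : C.path t ∈ Set.range (D.arc e) := by rw [← hrange]; exact hte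
    exact (hC.crosses e).1.unique ⟨ht, hte'⟩ ⟨hτ1 e, hτA e⟩
  · intro e; simpa using (hC.crosses e).2.2.1
  · intro e; simpa using (hC.crosses e).2.1
  · intro e h; exact (hC.crosses e).2.2.2 (by
      simp only [Path.source, Path.target] at h
      exact h.symm)
  · intro e e'; simpa using hC.sameSide_recOf e e'
  · simpa using fun h => hne (Sum.inr.inj (D.vert_injective h))

end Plane

/-! ### Recursion for sub-Pfaffians -/

section SubPfaffian

variable {n : ℕ}

theorem sPf_eq_of_strictMono (z : Matrix (Fin n) (Fin n) ℂ) {k : ℕ} {e : Fin k → Fin n}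
    (he : StrictMono e) {I : Finset (Fin n)} (hI : Finset.univ.image e = I) :
    sPf z I = pfaffian k (z.submatrix e e) := by
  have hk : I.card = k := by
    rw [← hI, Finset.card_image_of_injective _ he.injective, Finset.card_fin]
  subst hk
  have : e = I.orderEmbOfFin rfl :=
    Finset.orderEmbOfFin_unique rfl (fun x =>
      hI.le (Finset.mem_image_of_mem e (Finset.mem_univ x))) he
  rw [sPf, this]

@[simp]
theorem sPf_empty (z : Matrix (Fin n) (Fin n) ℂ) : sPf z ∅ = 1 := by
  rw [sPf_eq_of_strictMono z (e := Fin.elim0) (fun i => i.elim0) (by simp), pfaffian]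

/-- Expansion of a sub-Pfaffian along its first row. -/
theorem sPf_insert (z : Matrix (Fin n) (Fin n) ℂ) {p : Fin n} {J : Finset (Fin n)}
    (hp : ∀ q ∈ J, p < q) : sPf z (insert p J) =
      ∑ q ∈ J, (-1) ^ (J.filter (· < q)).card * z p q * sPf z (J.erase q) := by
  rcases hm : J.card with _ | m
  · rw [Finset.card_eq_zero] at hm
    subst hm
    rw [sPf_eq_of_strictMono z (e := fun _ : Fin 1 => p) (Subsingleton.strictMono _) (by simp),
      pfaffian, Finset.sum_empty]
  set e := J.orderEmbOfFin hm with he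
  have heJ : Finset.univ.image e = J := by
    rw [he]; exact Finset.image_orderEmbOfFin_univ J hm
  have hpe : ∀ j, p < e j := fun j => hp _ (Finset.orderEmbOfFin_mem J hm j)
  have hcons : StrictMono (Fin.cons p e : Fin (m + 2) → Fin n) := by
    intro i j hij
    refine Fin.cases ?_ (fun i hij => ?_) i hij
    · refine Fin.cases (fun h => absurd h (lt_irrefl _)) (fun j _ => ?_) j
      simpa using hpe j
    · revert hij
      refine Fin.cases (fun h => absurd h (Fin.not_lt_zero _)) (fun j h => ?_) j
      simpa using h
  rw [sPf_eq_of_strictMono z hcons (by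
    conv_rhs => rw [← heJ]
    ext q
    simp [Fin.exists_fin_succ, eq_comm]), pfaffian]
  have hJsum : ∀ F : Fin n → ℂ, ∑ q ∈ J, F q = ∑ j, F (e j) := by
    intro F
    conv_lhs => rw [← heJ]
    exact Finset.sum_image fun i _ j _ h => e.injective h
  rw [hJsum]
  refine Finset.sum_congr rfl fun j _ => ?_
  congr 1
  · congr 1
    congr 1
    have : J.filter (· < e j) = (Finset.Iio j).image e := by
      conv_lhs => rw [← heJ]
      ext q
      simp only [Finset.mem_filter, Finset.mem_image, Finset.mem_univ, true_and, Finset.mem_Iio]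
      constructor
      · rintro ⟨⟨i, rfl⟩, hi⟩
        exact ⟨i, e.lt_iff_lt.1 hi, rfl⟩
      · rintro ⟨i, hi, rfl⟩
        exact ⟨⟨i, rfl⟩, e.lt_iff_lt.2 hi⟩
    rw [this, Finset.card_image_of_injective _ e.injective, Fin.card_Iio]
  · rw [sPf_eq_of_strictMono z (e := fun k => e (j.succAbove k))
      (e.strictMono.comp (Fin.strictMono_succAbove j))]
    · rfl
    · conv_rhs => rw [← heJ]
      ext q
      simp only [Finset.mem_image, Finset.mem_univ, true_and, Finset.mem_erase]
      constructor
      · rintro ⟨k, rfl⟩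
        exact ⟨fun h => Fin.succAbove_ne j k (e.injective h), _, rfl⟩
      · rintro ⟨hq, i, rfl⟩
        obtain ⟨k, hk⟩ := Fin.exists_succAbove_eq (x := i) (y := j) fun h => hq (by rw [h])
        exact ⟨k, by rw [hk]⟩

theorem sPf_pair (z : Matrix (Fin n) (Fin n) ℂ) {p q : Fin n} (h : p < q) :
    sPf z {p, q} = z p q := by
  have := sPf_insert z (p := p) (J := {q}) (by simpa using h)
  simpa [Finset.filter_singleton] using this

/-- `v` satisfies the expansion along the first row. -/
def SatisfiesExpansion (v : Finset (Fin n) → ℂ) : Prop :=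
  ∀ p J, (∀ q ∈ J, p < q) →
    v (insert p J) = ∑ q ∈ J, (-1) ^ (J.filter (· < q)).card * v {p, q} * v (J.erase q)

theorem exists_insert_of_nonempty {I : Finset (Fin n)} (hI : I.Nonempty) :
    ∃ p J, (∀ q ∈ J, p < q) ∧ p ∉ J ∧ I = insert p J := by
  refine ⟨I.min' hI, I.erase (I.min' hI), fun q hq => ?_, Finset.notMem_erase _ _,
    (Finset.insert_erase (I.min'_mem hI)).symm⟩
  exact I.min'_lt_of_mem_erase_min' hI hq

/-- The expansion at the least element of `I` is a recursion that determines a vector from its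
entries at `∅` and at pairs. With `J = ∅` it also forces the entries at singletons to vanish. -/
theorem sPf_eq_of_satisfiesExpansion {v : Finset (Fin n) → ℂ} (h0 : v ∅ = 1)
    (hv : SatisfiesExpansion v) {z : Matrix (Fin n) (Fin n) ℂ}
    (hz : ∀ p q, p < q → z p q = v {p, q}) : sPf z = v := by
  funext I
  induction I using Finset.strongInduction with
  | H I ih =>
    rcases I.eq_empty_or_nonempty with rfl | hI
    · rw [sPf_empty, h0]
    · obtain ⟨p, J, hp, hpJ, rfl⟩ := exists_insert_of_nonempty hI
      rw [sPf_insert z hp, hv p J hp]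
      refine Finset.sum_congr rfl fun q hq => ?_
      rw [hz p q (hp q hq), ih (J.erase q) ((Finset.erase_ssubset hq).trans_subset
        (Finset.subset_insert p J))]

theorem exists_isSkew_sPf_eq {v : Finset (Fin n) → ℂ} (h0 : v ∅ = 1)
    (hv : SatisfiesExpansion v) : ∃ z, IsSkew z ∧ sPf z = v := by
  refine ⟨Matrix.of fun i j => if i < j then v {i, j} else if j < i then - v {j, i} else 0, ?_,
    sPf_eq_of_satisfiesExpansion h0 hv fun p q hpq => by simp [hpq]⟩
  ext i j
  rcases lt_trichotomy i j with h | rfl | h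
  · simp [h, h.not_gt]
  · simp
  · simp [h, h.not_gt]

/-- A skew matrix is read off from its sub-Pfaffians at pairs, with a sign that depends on the order
of the pair. So `π` may invert only pairs whose entry is zero. -/
theorem permMatrix_eq {π : Equiv.Perm (Fin n)} {z z' : Matrix (Fin n) (Fin n) ℂ} (hz : IsSkew z)
    (hz' : IsSkew z') (h : sPf z' = permVec π (sPf z))
    (hπ : ∀ i j, i < j → sPf z {i, j} ≠ 0 → π i < π j) : permMatrix π z = z' := by
  have skew : ∀ {z : Matrix (Fin n) (Fin n) ℂ}, IsSkew z → ∀ i j, z j i = - z i j :=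
    fun hz i j => congrFun (congrFun hz i) j
  have hpair : ∀ i j, sPf z' {π i, π j} = sPf z {i, j} := fun i j => by
    rw [h, permVec]
    simp [Finset.map_insert]
  have key : ∀ i j, i < j → z i j = z' (π i) (π j) := by
    intro i j hij
    have hzij := sPf_pair z hij
    by_cases h0 : sPf z {i, j} = 0
    · rw [← hzij, h0]
      rcases lt_or_gt_of_ne (π.injective.ne hij.ne) with hlt | hgt
      · rw [← sPf_pair z' hlt, hpair, h0]
      · rw [skew hz', ← sPf_pair z' hgt, Finset.pair_comm, hpair, h0, neg_zero]
    · rw [← hzij, ← sPf_pair z' (hπ i j hij h0), hpair]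
  have all : ∀ i j, z i j = z' (π i) (π j) := by
    intro i j
    rcases lt_trichotomy i j with hij | rfl | hij
    · exact key i j hij
    · rw [self_eq_neg.1 (skew hz i i), self_eq_neg.1 (skew hz' (π i) (π i))]
    · rw [skew hz j i, skew hz' (π j) (π i), key j i hij]
  ext i j
  simp [permMatrix, all]

/-- A vector that satisfies the expansion vanishes on sets of odd cardinality. -/
theorem eq_zero_of_odd_card {v : Finset (Fin n) → ℂ} {s : Finset (Fin n)}
    (hv : ∀ p J, insert p J ⊆ s → (∀ q ∈ J, p < q) →
      v (insert p J) = ∑ q ∈ J, (-1) ^ (J.filter (· < q)).card * v {p, q} * v (J.erase q))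
    {I : Finset (Fin n)} (hIs : I ⊆ s) (hI : Odd I.card) : v I = 0 := by
  induction I using Finset.strongInduction with
  | H I ih =>
    obtain ⟨p, J, hp, hpJ, rfl⟩ := exists_insert_of_nonempty (Finset.card_pos.1 hI.pos)
    rw [hv p J hIs hp]
    refine Finset.sum_eq_zero fun q hq => ?_
    have hsub : J.erase q ⊂ insert p J :=
      (Finset.erase_ssubset hq).trans_subset (Finset.subset_insert p J)
    rw [ih _ hsub (hsub.subset.trans hIs), mul_zero]
    rw [Finset.card_insert_of_notMem hpJ] at hI
    rw [Finset.card_erase_of_mem hq]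
    have := Finset.card_pos.2 ⟨q, hq⟩
    obtain ⟨k, hk⟩ := hI
    exact ⟨k - 1, by omega⟩

/-- The product over the blocks of a non-crossing partition of vectors that satisfy the expansion
on their blocks satisfies the expansion. -/
theorem satisfiesExpansion_prod {W : Type*} [Fintype W] [DecidableEq W] {g : Fin n → W}
    (hg : ∀ i j k l, i < j → j < k → k < l → g i = g k → g j = g l → g i = g j)
    {u : W → Finset (Fin n) → ℂ} (hu0 : ∀ w, u w ∅ = 1)
    (hu : ∀ w I, u w I = u w (I.filter (g · = w)))
    (hexp : ∀ w p J, insert p J ⊆ Finset.univ.filter (g · = w) → (∀ q ∈ J, p < q) →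
      u w (insert p J) =
        ∑ q ∈ J, (-1) ^ (J.filter (· < q)).card * u w {p, q} * u w (J.erase q)) :
    SatisfiesExpansion (fun I => ∏ w, u w I) := by
  intro p J hp
  have hsplit : ∀ I, ∏ w, u w I = u (g p) I * ∏ w ∈ Finset.univ.erase (g p), u w I := fun I =>
    (Finset.mul_prod_erase _ _ (Finset.mem_univ _)).symm
  have hsingle : u (g p) {p} = 0 := by
    simpa using hexp (g p) p ∅ (by simp) (by simp)
  have hpair_ne : ∀ q, g q ≠ g p → ∏ w, u w {p, q} = 0 := fun q hq => by
    rw [hsplit, hu, Finset.filter_insert, if_pos rfl, Finset.filter_singleton, if_neg hq]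
    simp [hsingle]
  have hother : ∀ {I I' : Finset (Fin n)}, (∀ q, g q ≠ g p → (q ∈ I ↔ q ∈ I')) →
      ∏ w ∈ Finset.univ.erase (g p), u w I = ∏ w ∈ Finset.univ.erase (g p), u w I' := by
    intro I I' h
    refine Finset.prod_congr rfl fun w hw => ?_
    rw [hu w I, hu w I']
    congr 1
    ext q
    simp only [Finset.mem_filter, and_congr_left_iff]
    rintro rfl
    exact h q (Finset.ne_of_mem_erase hw)
  have hpair : ∀ q, g q = g p → ∏ w, u w {p, q} = u (g p) {p, q} := fun q hq => by
    rw [hsplit, hother (I' := ∅), Finset.prod_eq_one fun w _ => hu0 w, mul_one]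
    intro r hr
    simp only [Finset.mem_insert, Finset.mem_singleton, Finset.notMem_empty, iff_false, not_or]
    exact ⟨fun h => hr (by rw [h]), fun h => hr (by rw [h, hq])⟩
  -- Only `q` in the block of `p` contribute, and `Q`, the product over the other blocks, is a
  -- common factor. What remains is the expansion in the block of `p`, up to a comparison of signs.
  set Q := ∏ w ∈ Finset.univ.erase (g p), u w J with hQ
  set J' := J.filter (g · = g p) with hJ'
  have hleft : ∏ w, u w (insert p J) = u (g p) (insert p J') * Q := by
    rw [hsplit, hu (g p), Finset.filter_insert, if_pos rfl, hother (I' := J)]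
    intro q hq
    simp only [Finset.mem_insert, or_iff_right_iff_imp]
    exact fun h => absurd (by rw [h]) hq
  have hright : ∀ q ∈ J', ∏ w, u w (J.erase q) = u (g p) (J'.erase q) * Q := by
    intro q hq
    rw [hsplit, hu (g p), Finset.filter_erase, hother (I' := J)]
    intro r hr
    simp only [Finset.mem_erase, and_iff_right_iff_imp]
    rintro - rfl
    exact hr (Finset.mem_filter.1 hq).2
  have hsum : ∑ q ∈ J, (-1) ^ (J.filter (· < q)).card * (∏ w, u w {p, q}) * ∏ w, u w (J.erase q)
      = ∑ q ∈ J', (-1) ^ (J.filter (· < q)).card * u (g p) {p, q} * u (g p) (J'.erase q) * Q := by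
    rw [hJ', Finset.sum_filter]
    refine Finset.sum_congr rfl fun q hq => ?_
    by_cases hqp : g q = g p
    · rw [if_pos hqp, hpair q hqp, hright q (Finset.mem_filter.2 ⟨hq, hqp⟩), mul_assoc _ _ Q]
    · rw [if_neg hqp, hpair_ne q hqp, mul_zero, zero_mul]
  change ∏ w, u w (insert p J) = ∑ q ∈ J, (-1) ^ (J.filter (· < q)).card * (∏ w, u w {p, q}) *
    ∏ w, u w (J.erase q)
  rw [hsum, hleft]
  by_cases hQ0 : Q = 0
  · simp [hQ0]
  rw [hexp (g p) p J' (by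
    intro q hq
    rcases Finset.mem_insert.1 hq with rfl | hq
    · simp
    · exact Finset.mem_filter.2 ⟨Finset.mem_univ _, (Finset.mem_filter.1 hq).2⟩)
    (fun q hq => hp q (Finset.mem_filter.1 hq).1), Finset.sum_mul]
  refine Finset.sum_congr rfl fun q hq => ?_
  congr 3
  -- A block that meets `J` between `p` and `q` has all its elements of `J` before `q`, by
  -- non-crossing. Their number is even, as otherwise its factor in `Q` would vanish.
  have heven : ∀ w ∈ Finset.univ.erase (g p), Even ((J.filter (· < q)).filter (g · = w)).card := by
    intro w hw
    have hwp := Finset.ne_of_mem_erase hw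
    by_cases hex : ∃ r ∈ J, r < q ∧ g r = w
    · obtain ⟨r, hr, hrq, rfl⟩ := hex
      have hall : (J.filter (· < q)).filter (g · = g r) = J.filter (g · = g r) := by
        rw [Finset.filter_filter]
        refine Finset.filter_congr fun s hs => and_iff_right_of_imp fun hsr => ?_
        by_contra hsq
        rcases (not_lt.1 hsq).lt_or_eq with h | rfl
        · exact hwp (hg p r q s (hp r hr) hrq h (Finset.mem_filter.1 hq).2.symm hsr.symm).symm
        · exact hwp (hsr.symm.trans (Finset.mem_filter.1 hq).2)
      rw [hall]
      by_contra hodd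
      refine Finset.prod_ne_zero_iff.1 hQ0 (g r) hw ?_
      rw [hu]
      exact eq_zero_of_odd_card (hexp (g r)) (Finset.filter_subset_filter _ (Finset.subset_univ J))
        (Nat.not_even_iff_odd.1 hodd)
    · have : (J.filter (· < q)).filter (g · = w) = ∅ := by
        refine Finset.filter_eq_empty_iff.2 fun r hr hrw => hex ?_
        exact ⟨r, (Finset.mem_filter.1 hr).1, (Finset.mem_filter.1 hr).2, hrw⟩
      rw [this]
      simp
  have hcard : (J.filter (· < q)).card = (J'.filter (· < q)).card +
      ∑ w ∈ Finset.univ.erase (g p), ((J.filter (· < q)).filter (g · = w)).card := by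
    rw [Finset.card_eq_sum_card_fiberwise (f := g) (t := Finset.univ)
      (fun _ _ => Finset.mem_univ _),
      ← Finset.add_sum_erase _ _ (Finset.mem_univ (g p)), hJ', Finset.filter_comm]
  rw [hcard, pow_add, (Finset.even_sum _ heven).neg_one_pow, mul_one]

end SubPfaffian

/-! ### Products of tensors that satisfy the Grassmann–Plücker relations -/

section Tensor

variable {n : ℕ} {ε W : Type*} {f : ε → W}

/-- The normalized coordinates of the tensor at `w`, indexed by sets of positions of edges. -/
noncomputable def localVec (A : Fin n ≃ ε) (τ : (w : W) → (EdgesAt f w → Fin 2) → ℂ) (w : W)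
    (I : Finset (Fin n)) : ℂ :=
  (τ w fun _ => 0)⁻¹ * τ w (fun e => if A.symm e.1 ∈ I then 1 else 0)

theorem orderVec_normalizeFirst_globalTensor [DecidableEq ε] [Fintype W] (A : Fin n ≃ ε)
    (τ : (w : W) → (EdgesAt f w → Fin 2) → ℂ) :
    orderVec A (normalizeFirst (globalTensor f τ)) = fun I => ∏ w, localVec A τ w I := by
  funext I
  simp only [orderVec, coord, normalizeFirst, globalTensor, localVec, Finset.prod_mul_distrib,
    Finset.prod_inv_distrib, Finset.mem_map_equiv]

theorem localVec_empty (A : Fin n ≃ ε) {τ : (w : W) → (EdgesAt f w → Fin 2) → ℂ}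
    (h0 : ∀ w, τ w (fun _ => 0) ≠ 0) (w : W) : localVec A τ w ∅ = 1 := by
  simp [localVec, h0 w]

theorem localVec_filter [DecidableEq W] (A : Fin n ≃ ε)
    (τ : (w : W) → (EdgesAt f w → Fin 2) → ℂ) (w : W) (I : Finset (Fin n)) :
    localVec A τ w I = localVec A τ w (I.filter fun i => f (A i) = w) := by
  unfold localVec
  congr 2
  funext e
  simp [e.2]

theorem localVec_insert [DecidableEq ε] [DecidableEq W] {A : Fin n ≃ ε}
    {τ : (w : W) → (EdgesAt f w → Fin 2) → ℂ} (h0 : ∀ w, τ w (fun _ => 0) ≠ 0) (w : W)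
    (hGP : GrassmannPlucker (fun e : EdgesAt f w => A.symm e.1) (fun I => coord (τ w) I))
    (p : Fin n) (J : Finset (Fin n))
    (hJ : insert p J ⊆ Finset.univ.filter fun i => f (A i) = w) (hp : ∀ q ∈ J, p < q) :
    localVec A τ w (insert p J) = ∑ q ∈ J,
      (-1) ^ (J.filter (· < q)).card * localVec A τ w {p, q} * localVec A τ w (J.erase q) := by
  let pos : EdgesAt f w ↪ Fin n := (Function.Embedding.subtype _).trans A.symm.toEmbedding
  have hpos : ∀ e, pos e = A.symm e.1 := fun _ => rfl
  have hloc : ∀ I : Finset (EdgesAt f w), localVec A τ w (I.map pos) =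
      (τ w fun _ => 0)⁻¹ * coord (τ w) I := by
    intro I
    unfold localVec coord
    congr 2
    funext e
    simp only [← hpos, Finset.mem_map']
  obtain ⟨e, rfl⟩ : ∃ e, pos e = p :=
    ⟨⟨A p, (Finset.mem_filter.1 (hJ (Finset.mem_insert_self p J))).2⟩, by simp [hpos]⟩
  obtain ⟨K, rfl⟩ : ∃ K : Finset (EdgesAt f w), K.map pos = J := by
    refine ⟨(J.map A.toEmbedding).subtype (f · = w), ?_⟩
    ext q
    simp only [Finset.mem_map, Finset.mem_subtype, Equiv.coe_toEmbedding, hpos]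
    constructor
    · rintro ⟨e, ⟨r, hr, hre⟩, rfl⟩
      rwa [← hre, Equiv.symm_apply_apply]
    · intro hq
      exact ⟨⟨A q, (Finset.mem_filter.1 (hJ (Finset.mem_insert_of_mem hq))).2⟩, ⟨q, hq, rfl⟩,
        by simp⟩
  have hpK : ∀ d ∈ K, pos e < pos d := fun d hd => hp _ (Finset.mem_map_of_mem pos hd)
  have heK : e ∉ K := fun he => (hpK e he).false
  have hsymm : symmDiff {e} K = insert e K := by
    rw [(Finset.disjoint_singleton_left.2 heK).symmDiff_eq_sup]
    rfl
  -- The term at `e` is the entry at `∅` times the entry at `insert e K`; the terms at `d ∈ K` are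
  -- those of the expansion.
  have rel := hGP {e} K
  rw [hsymm, Finset.sum_insert heK] at rel
  have hfirst : (insert e K).filter (fun q => A.symm q.1 < A.symm e.1) = ∅ := by
    refine Finset.filter_eq_empty_iff.2 fun d hd => ?_
    rcases Finset.mem_insert.1 hd with rfl | hd
    · exact lt_irrefl _
    · exact (hpK d hd).not_gt
  have hKe : symmDiff K {e} = insert e K := by rw [symmDiff_comm, hsymm]
  -- The minus sign arises because `e` itself precedes `d`.
  have hterm : ∀ d ∈ K, (-1 : ℂ) ^ ((insert e K).filter (fun q => A.symm q.1 < A.symm d.1)).card *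
      coord (τ w) (symmDiff {e} {d}) * coord (τ w) (symmDiff K {d}) =
      - ((-1) ^ (K.filter (fun q => pos q < pos d)).card * coord (τ w) {e, d} *
        coord (τ w) (K.erase d)) := by
    intro d hd
    have hed : e ≠ d := fun h => heK (h ▸ hd)
    have h1 : symmDiff {e} {d} = ({e, d} : Finset (EdgesAt f w)) := by
      rw [(Finset.disjoint_singleton.2 hed).symmDiff_eq_sup]
      rfl
    have h2 : symmDiff K {d} = K.erase d := by
      rw [symmDiff_of_ge (Finset.singleton_subset_iff.2 hd), Finset.sdiff_singleton_eq_erase]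
    have hlt : A.symm e.1 < A.symm d.1 := hpK d hd
    rw [h1, h2, Finset.filter_insert, if_pos hlt, Finset.card_insert_of_notMem
      (fun h => heK (Finset.mem_filter.1 h).1), pow_succ]
    simp only [hpos]
    ring
  rw [hfirst, symmDiff_self, hKe, Finset.sum_congr rfl hterm, Finset.sum_neg_distrib,
    Finset.card_empty, pow_zero, one_mul, add_neg_eq_zero] at rel
  have hempty : coord (τ w) ⊥ = τ w fun _ => 0 := by simp [coord]
  simp only [hempty] at rel
  rw [← Finset.map_insert, hloc, Finset.sum_map]
  have hpair : ∀ d, ({pos e, pos d} : Finset (Fin n)) = ({e, d} : Finset _).map pos := fun d => by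
    rw [Finset.map_insert, Finset.map_singleton]
  have hsum : ∑ d ∈ K, (-1 : ℂ) ^ ((K.map pos).filter (· < pos d)).card *
      localVec A τ w {pos e, pos d} * localVec A τ w ((K.map pos).erase (pos d)) =
      ((τ w fun _ => 0)⁻¹ * (τ w fun _ => 0)⁻¹) * ∑ d ∈ K,
        (-1) ^ (K.filter (fun q => pos q < pos d)).card * coord (τ w) {e, d} *
        coord (τ w) (K.erase d) := by
    rw [Finset.mul_sum]
    refine Finset.sum_congr rfl fun d _ => ?_
    rw [hpair, ← Finset.map_erase, hloc, hloc, Finset.filter_map, Finset.card_map]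
    simp only [Function.comp_def]
    ring
  rw [hsum, ← rel]
  have := h0 w
  field_simp

theorem exists_isSkew_sPf_eq_orderVec [DecidableEq ε] [Fintype W] [DecidableEq W] {A : Fin n ≃ ε}
    (hA : IsNonCrossingOrder f A) {τ : (w : W) → (EdgesAt f w → Fin 2) → ℂ}
    (h0 : ∀ w, τ w (fun _ => 0) ≠ 0)
    (hGP : ∀ w, GrassmannPlucker (fun e : EdgesAt f w => A.symm e.1) (fun I => coord (τ w) I)) :
    ∃ z, IsSkew z ∧ sPf z = orderVec A (normalizeFirst (globalTensor f τ)) := by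
  rw [orderVec_normalizeFirst_globalTensor]
  refine exists_isSkew_sPf_eq (Finset.prod_eq_one fun w _ => localVec_empty A h0 w) ?_
  exact satisfiesExpansion_prod (g := fun i => f (A i)) hA (localVec_empty A h0)
    (localVec_filter A τ) fun w => localVec_insert h0 w (hGP w)

/-- The factor at the end of `A i` is an entry at a singleton, which the expansion makes zero. -/
theorem orderVec_pair_eq_zero [DecidableEq ε] [Fintype W] [DecidableEq W] {A : Fin n ≃ ε}
    {τ : (w : W) → (EdgesAt f w → Fin 2) → ℂ} (h0 : ∀ w, τ w (fun _ => 0) ≠ 0)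
    (hGP : ∀ w, GrassmannPlucker (fun e : EdgesAt f w => A.symm e.1) (fun I => coord (τ w) I))
    {i j : Fin n} (hij : f (A i) ≠ f (A j)) :
    orderVec A (normalizeFirst (globalTensor f τ)) {i, j} = 0 := by
  rw [orderVec_normalizeFirst_globalTensor]
  refine Finset.prod_eq_zero (Finset.mem_univ (f (A i))) ?_
  rw [localVec_filter, Finset.filter_insert, if_pos rfl, Finset.filter_singleton, if_neg hij.symm]
  exact localVec_insert h0 _ (hGP _) i ∅ (by simp) (by simp)

theorem permVec_orderVec [DecidableEq ε] (A B : Fin n ≃ ε) (τ : (ε → Fin 2) → ℂ) :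
    permVec (orderPerm A B) (orderVec A τ) = orderVec B τ := by
  funext I
  simp only [permVec, orderVec]
  congr 1
  ext e
  simp only [Finset.mem_map_equiv, Equiv.symm_symm]
  simp [orderPerm]

theorem GrassmannPlucker.of_lt_iff_lt {κ : Type*} [DecidableEq κ] {m : ℕ} {pos : κ → Fin n}
    {pos' : κ → Fin m} {τ : Finset κ → ℂ} (h : GrassmannPlucker pos τ)
    (hlt : ∀ e e', pos e < pos e' ↔ pos' e < pos' e') : GrassmannPlucker pos' τ := by
  intro α β
  simpa only [hlt] using h α β

/-- All claims about the generators, for a non-crossing order `B` in place of the order given by a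
curve. -/
theorem sPf_claims_of_isNonCrossingOrder [DecidableEq ε] [Fintype W] [DecidableEq W]
    {A B : Fin n ≃ ε}
    (hB : IsNonCrossingOrder f B) (hAB : IsLexMinGroupedOrder f B A)
    {τ : (w : W) → (EdgesAt f w → Fin 2) → ℂ} (h0 : ∀ w, τ w (fun _ => 0) ≠ 0)
    (hGP : ∀ w, GrassmannPlucker (fun e : EdgesAt f w => A.symm e.1) (fun I => coord (τ w) I)) :
    (∃ z, IsSkew z ∧ sPf z = orderVec A (normalizeFirst (globalTensor f τ))) ∧
    (∀ z, IsSkew z → sPf z = orderVec A (normalizeFirst (globalTensor f τ)) →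
      sPf (permMatrix (orderPerm A B) z) = permVec (orderPerm A B) (sPf z)) ∧
    (∃ z, IsSkew z ∧ sPf z = orderVec B (normalizeFirst (globalTensor f τ))) := by
  -- The relations at `w` depend only on the relative order of the edges at `w`.
  have hGP' : ∀ w, GrassmannPlucker (fun e : EdgesAt f w => B.symm e.1)
      (fun I => coord (τ w) I) := fun w =>
    (hGP w).of_lt_iff_lt fun e e' => hAB.lt_iff_lt (e.2.trans e'.2.symm)
  have hex := exists_isSkew_sPf_eq_orderVec hB h0 hGP'
  refine ⟨exists_isSkew_sPf_eq_orderVec hAB.1.isNonCrossingOrder h0 hGP, fun z hz hzA => ?_, hex⟩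
  obtain ⟨z', hz', hzB⟩ := hex
  have hperm : sPf z' = permVec (orderPerm A B) (sPf z) := by rw [hzA, permVec_orderVec, hzB]
  rw [permMatrix_eq hz hz' hperm, hperm]
  intro i j hij hne
  have hf : f (A i) = f (A j) := by
    by_contra hf
    exact hne (by rw [hzA, orderVec_pair_eq_zero h0 hGP hf])
  simpa [orderPerm] using (hAB.lt_iff_lt hf).1 (by simpa using hij)

/-! ### Duality between recognizers and generators -/

/-- Exchange of the two basis vectors in all slots. -/
def flipTensor {κ : Type*} (τ : (κ → Fin 2) → ℂ) : (κ → Fin 2) → ℂ := fun x => τ fun e => (x e).rev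

theorem coord_flipTensor {κ : Type*} [DecidableEq κ] [Fintype κ] (τ : (κ → Fin 2) → ℂ)
    (I : Finset κ) : coord (flipTensor τ) I = coord τ Iᶜ := by
  unfold coord flipTensor
  congr 1
  funext e
  by_cases h : e ∈ I <;> simp [h]

theorem orderVec_flipTensor [DecidableEq ε] (A : Fin n ≃ ε) (τ : (ε → Fin 2) → ℂ)
    (I : Finset (Fin n)) : orderVec A (flipTensor τ) I = orderVec A τ Iᶜ := by
  unfold orderVec coord flipTensor
  congr 1
  funext e
  by_cases h : A.symm e ∈ I <;> simp [h, Finset.mem_map_equiv]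

/-- The reverse of `0 : Fin 2` is `1` by computation, so normalizing the first entry after the flip
normalizes the last entry before it. -/
theorem normalizeFirst_globalTensor_flipTensor [Fintype W]
    (τ : (w : W) → (EdgesAt f w → Fin 2) → ℂ) :
    normalizeFirst (globalTensor f fun w => flipTensor (τ w)) =
      flipTensor (normalizeLast (globalTensor f τ)) := rfl

theorem sPfDual_eq_orderVec_iff [DecidableEq ε] {A : Fin n ≃ ε} {τ : (ε → Fin 2) → ℂ}
    {y : Matrix (Fin n) (Fin n) ℂ} :
    sPfDual y = orderVec A τ ↔ sPf y = orderVec A (flipTensor τ) := by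
  constructor <;> intro h <;> funext I
  · rw [orderVec_flipTensor, ← h, sPfDual, compl_compl]
  · rw [sPfDual, h, orderVec_flipTensor, compl_compl]

theorem permVec_sPfDual (π : Equiv.Perm (Fin n)) (y : Matrix (Fin n) (Fin n) ℂ)
    (I : Finset (Fin n)) : permVec π (sPfDual y) I = permVec π (sPf y) Iᶜ := by
  simp only [permVec, sPfDual]
  congr 1
  ext i
  simp [Finset.mem_map_equiv]

/-- The flip turns complementary indexing into ordinary indexing and `sPfDual` into `sPf`;
permutations commute with complements. -/
theorem sPfDual_claims_of_isNonCrossingOrder [DecidableEq ε] [Fintype W] [DecidableEq W]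
    {A B : Fin n ≃ ε}
    (hB : IsNonCrossingOrder f B) (hAB : IsLexMinGroupedOrder f B A)
    {τ : (w : W) → (EdgesAt f w → Fin 2) → ℂ} (h1 : ∀ w, τ w (fun _ => 1) ≠ 0)
    [∀ w, Fintype (EdgesAt f w)]
    (hGP : ∀ w, GrassmannPlucker (fun e : EdgesAt f w => A.symm e.1) (fun I => coord (τ w) Iᶜ)) :
    (∃ y, IsSkew y ∧ sPfDual y = orderVec A (normalizeLast (globalTensor f τ))) ∧
    (∀ y, IsSkew y → sPfDual y = orderVec A (normalizeLast (globalTensor f τ)) →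
      sPfDual (permMatrix (orderPerm A B) y) = permVec (orderPerm A B) (sPfDual y)) ∧
    (∃ y, IsSkew y ∧ sPfDual y = orderVec B (normalizeLast (globalTensor f τ))) := by
  simp only [sPfDual_eq_orderVec_iff, ← normalizeFirst_globalTensor_flipTensor]
  simp only [← coord_flipTensor] at hGP
  obtain ⟨hex, hperm, hexB⟩ :=
    sPf_claims_of_isNonCrossingOrder (τ := fun w => flipTensor (τ w)) hB hAB h1 hGP
  refine ⟨hex, fun y hy hyA => ?_, hexB⟩
  funext I
  rw [permVec_sPfDual, ← hperm y hy hyA, sPfDual]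

end Tensor

theorem mainTheorem3 {V U : Type*} [Fintype V] [Fintype U] [DecidableEq V] [DecidableEq U]
    -- the bipartite graph, with a plane embedding
    (E : Finset (V × U)) (D : PlaneEmbedding E)
    -- generators, recognizers, and changes of basis of the spaces `ℂ²` at the edges
    (G₀ : (x : V) → (EdgesAt (genOf (E := E)) x → Fin 2) → ℂ)
    (R₀ : (c : U) → (EdgesAt (recOf (E := E)) c → Fin 2) → ℂ)
    (T : E → Matrix.GeneralLinearGroup (Fin 2) ℂ)
    -- the generators and recognizers in the new bases
    (G : (x : V) → (EdgesAt (genOf (E := E)) x → Fin 2) → ℂ)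
    (hG : ∀ x, G x = changeBasis (fun e => (T e.1).val) (G₀ x))
    (R : (c : U) → (EdgesAt (recOf (E := E)) c → Fin 2) → ℂ)
    (hR : ∀ c, R c = changeBasis (fun e => ((T e.1)⁻¹).val.transpose) (R₀ c))
    -- the curve, its edge order, and the corresponding generator and recognizer orders
    (C : SimpleClosedCurve) (hC : IsCrossingCurve D C)
    {n : ℕ} (EC EG ER : Fin n ≃ E) (hEC : IsCurveOrder D C EC)
    (hEG : IsLexMinGroupedOrder genOf EC EG) (hER : IsLexMinGroupedOrder recOf EC ER)
    -- the Grassmann–Plücker relations, and the entries to be normalized do not vanish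
    (hGP : ∀ x, GrassmannPlucker (fun e => EG.symm e.1) (fun I => coord (G x) I))
    (hG0 : ∀ x, G x (fun _ => 0) ≠ 0)
    (hRP : ∀ c, GrassmannPlucker (fun e => ER.symm e.1) (fun I => coord (R c) Iᶜ))
    (hR1 : ∀ c, R c (fun _ => 1) ≠ 0) :
    -- generators
    (∃ z : Matrix (Fin n) (Fin n) ℂ, IsSkew z ∧
      sPf z = orderVec EG (normalizeFirst (globalTensor genOf G))) ∧
    (∀ z : Matrix (Fin n) (Fin n) ℂ, IsSkew z →
      sPf z = orderVec EG (normalizeFirst (globalTensor genOf G)) →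
      sPf (permMatrix (orderPerm EG EC) z) = permVec (orderPerm EG EC) (sPf z)) ∧
    (∀ (I : Finset E) (S : Finset (Finset E)), IsPairingAlong genOf I S →
      crossingNumber EC S = ∑ x : V, crossingNumber EG (pairingAt genOf x S)) ∧
    -- recognizers
    (∃ y : Matrix (Fin n) (Fin n) ℂ, IsSkew y ∧
      sPfDual y = orderVec ER (normalizeLast (globalTensor recOf R))) ∧
    (∀ y : Matrix (Fin n) (Fin n) ℂ, IsSkew y →
      sPfDual y = orderVec ER (normalizeLast (globalTensor recOf R)) →
      sPfDual (permMatrix (orderPerm ER EC) y) = permVec (orderPerm ER EC) (sPfDual y)) ∧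
    (∀ (I : Finset E) (S : Finset (Finset E)), IsPairingAlong recOf I S →
      crossingNumber EC S = ∑ c : U, crossingNumber ER (pairingAt recOf c S)) ∧
    -- validity
    IsValidOrder EC (normalizeFirst (globalTensor genOf G))
      (normalizeLast (globalTensor recOf R)) := by
  have hgen := hC.isNonCrossingOrder_genOf hEC
  have hrec := hC.isNonCrossingOrder_recOf hEC
  obtain ⟨hz, hzperm, z, hzs, hzC⟩ := sPf_claims_of_isNonCrossingOrder hgen hEG hG0 hGP
  obtain ⟨hy, hyperm, y, hys, hyC⟩ := sPfDual_claims_of_isNonCrossingOrder hrec hER hR1 hRP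
  exact ⟨hz, hzperm, fun I S hS => crossingNumber_eq_sum_of_isNonCrossingOrder hgen
      (fun _ _ => hEG.lt_iff_lt) hS, hy, hyperm,
    fun I S hS => crossingNumber_eq_sum_of_isNonCrossingOrder hrec
      (fun _ _ => hER.lt_iff_lt) hS, z, y, hzs, hys, hzC, hyC⟩
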